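/- Let $k$ be an algebraically closed field, let $Q=(Q_0,Q_1,s,t)$ be a finite quiver (not necessarily connected), and let $I$ be a two-sided ideal of the path algebra $kQ$ that is contained in the ideal generated by the arrows (for instance, an admissible ideal). Let $S=kQ/I$, and let $E\colon Q_0\to Q_0$ be an involution (a map with $E(E(x))=x$ for all $x$; fixed points are allowed). Let $Q(E)$ be the quiver obtained from $Q$ by gluing each vertex $x$ to $E(x)$: its vertices are the sets $\bar x=\{x,E(x)\}$ for $x\in Q_0$, its arrows are the arrows of $Q$, and an arrow $\alpha$ of $Q$ goes in $Q(E)$ from $\overline{s(\alpha)}$ to $\overline{t(\alpha)}$. Every path of $Q$ is also a path of $Q(E)$, which gives a $k$-linear map $kQ\to kQ(E)$. Let $I(E)$ be the two-sided ideal of $kQ(E)$ generated by the image of $I$, and let $S_E=kQ(E)/I(E)$ (Brüstle's gluing algebra of $S$ along $E$). For a finite-dimensional $k$-algebra $A$, let $\operatorname{mod}A$ be the category of finitely generated left $A$-modules, $\operatorname{proj}A$ its subcategory of projective modules, and let $D_{sg}(A)=D^b(\operatorname{mod}A)/K^b(\operatorname{proj}A)$ (Verdier quotient) be the singularity category of $A$.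 Assume that $S$ and $S_E$ are finite-dimensional over $k$. Then $S$ and $S_E$ are singularity equivalent, i.e. there is an equivalence of triangulated categories $D_{sg}(S)\simeq D_{sg}(S_E)$. -/

import Mathlib

universe u v w w' w''

/-- A path of a quiver, together with its source and its target. -/
structure QuiverPath (V : Type v) [Quiver.{w} V] : Type max v w where
  /-- the vertex at which the path starts -/
  src : V
  /-- the vertex at which the path ends -/
  tgt : V
  /-- the path itself -/
  path : Quiver.Path src tgt

/-- The underlying vector space of the path algebra `kQ` of a quiver with vertex set `V`:
the `k`-vector space whose basis is the set of all paths of the quiver. -/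
def PathAlgebra (k : Type u) (V : Type v) [Quiver.{w} V] [Field k] : Type max u v w :=
  QuiverPath V →₀ k

noncomputable section
namespace PathAlgebra

section Module

variable (k : Type u) (V : Type v) [Field k] [Quiver.{w} V]

instance : AddCommGroup (PathAlgebra k V) := inferInstanceAs (AddCommGroup (QuiverPath V →₀ k))
instance : Module k (PathAlgebra k V) := inferInstanceAs (Module k (QuiverPath V →₀ k))

/-- The basis of the path algebra given by all paths. -/
def basis : Module.Basis (QuiverPath V) k (PathAlgebra k V) :=
  Module.Basis.ofRepr (LinearEquiv.refl k (QuiverPath V →₀ k))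

variable {V}

/-- A path, seen as an element of the path algebra. -/
def ofPath (p : QuiverPath V) : PathAlgebra k V := basis k V p

open Classical in
/-- The product of two paths: `p * q` is the concatenation "first `q`, then `p`" if `q` ends
where `p` starts, and it is `0` otherwise. -/
def mulPath (p q : QuiverPath V) : PathAlgebra k V :=
  if h : q.tgt = p.src then ofPath k ⟨q.src, p.tgt, q.path.comp (p.path.cast h.symm rfl)⟩ else 0

variable (V) in
/-- The bilinear extension of the product of paths. -/
def mulHom : PathAlgebra k V →ₗ[k] PathAlgebra k V →ₗ[k] PathAlgebra k V :=
  (basis k V).constr k fun p => (basis k V).constr k fun q => mulPath k p q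

instance : Mul (PathAlgebra k V) := ⟨fun f g => mulHom k V f g⟩

/-- The unit is the sum of all paths of length zero. -/
instance : One (PathAlgebra k V) := ⟨∑ᶠ i : V, ofPath k ⟨i, i, Quiver.Path.nil⟩⟩

variable {k}

theorem mul_def (f g : PathAlgebra k V) : f * g = mulHom k V f g := rfl

theorem one_def : (1 : PathAlgebra k V) = ∑ᶠ i : V, ofPath k ⟨i, i, Quiver.Path.nil⟩ := rfl

theorem ofPath_mul_ofPath (p q : QuiverPath V) : ofPath k p * ofPath k q = mulPath k p q := by
  simp [mul_def, mulHom, ofPath]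

theorem ofPath_mul_comp {i j l : V} (p : Quiver.Path j l) (q : Quiver.Path i j) :
    ofPath k ⟨j, l, p⟩ * ofPath k ⟨i, j, q⟩ = ofPath k ⟨i, l, q.comp p⟩ := by
  simp [ofPath_mul_ofPath, mulPath]

theorem ofPath_mul_of_ne (p q : QuiverPath V) (h : q.tgt ≠ p.src) :
    ofPath k p * ofPath k q = 0 := by
  simp [ofPath_mul_ofPath, mulPath, h]

theorem add_mul' (f g h : PathAlgebra k V) : (f + g) * h = f * h + g * h := by simp [mul_def]

theorem mul_add' (f g h : PathAlgebra k V) : f * (g + h) = f * g + f * h := by simp [mul_def]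

theorem smul_mul' (c : k) (f g : PathAlgebra k V) : (c • f) * g = c • (f * g) := by simp [mul_def]

theorem mul_smul' (c : k) (f g : PathAlgebra k V) : f * (c • g) = c • (f * g) := by simp [mul_def]

theorem zero_mul' (f : PathAlgebra k V) : 0 * f = 0 := by simp [mul_def]

theorem mul_zero' (f : PathAlgebra k V) : f * 0 = 0 := by simp [mul_def]

theorem basis_induction {motive : PathAlgebra k V → Prop} (f : PathAlgebra k V)
    (zero : motive 0) (add : ∀ f g, motive f → motive g → motive (f + g))
    (smul : ∀ (c : k) (p : QuiverPath V), motive (c • ofPath k p)) : motive f := by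
  rw [← (basis k V).linearCombination_repr f, Finsupp.linearCombination_apply]
  exact Finset.sum_induction _ motive add zero fun p _ => smul _ p

theorem mul_assoc' (f g h : PathAlgebra k V) : f * g * h = f * (g * h) := by
  induction f using basis_induction with
  | zero => simp only [zero_mul']
  | add a b ha hb => simp only [add_mul', ha, hb]
  | smul c p =>
  induction g using basis_induction with
  | zero => simp only [zero_mul', mul_zero']
  | add a b ha hb => simp only [add_mul', mul_add', ha, hb]
  | smul d q =>
  induction h using basis_induction with
  | zero => simp only [mul_zero']
  | add a b ha hb => simp only [mul_add', ha, hb]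
  | smul e r =>
  simp only [smul_mul', mul_smul']
  suffices H : ofPath k p * ofPath k q * ofPath k r = ofPath k p * (ofPath k q * ofPath k r) by
    rw [H]
  obtain ⟨i, j, p⟩ := p
  obtain ⟨i', j', q⟩ := q
  obtain ⟨i'', j'', r⟩ := r
  by_cases h1 : j' = i
  · subst h1
    rw [ofPath_mul_comp]
    by_cases h2 : j'' = i'
    · subst h2
      simp only [ofPath_mul_comp, Quiver.Path.comp_assoc]
    · rw [ofPath_mul_of_ne _ _ h2, ofPath_mul_of_ne _ _ h2, mul_zero']
  · rw [ofPath_mul_of_ne _ _ h1, zero_mul']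
    by_cases h2 : j'' = i'
    · subst h2
      rw [ofPath_mul_comp, ofPath_mul_of_ne _ _ h1]
    · rw [ofPath_mul_of_ne _ _ h2, mul_zero']

theorem one_mul' [Finite V] (f : PathAlgebra k V) : 1 * f = f := by
  have := Fintype.ofFinite V
  induction f using basis_induction with
  | zero => rw [mul_zero']
  | add a b ha hb => rw [mul_add', ha, hb]
  | smul c p =>
  obtain ⟨i, j, p⟩ := p
  rw [mul_smul', one_def, finsum_eq_sum_of_fintype, mul_def, map_sum, LinearMap.sum_apply,
    Finset.sum_eq_single j]
  · rw [← mul_def, ofPath_mul_comp, Quiver.Path.comp_nil]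
  · intro l _ hl
    rw [← mul_def, ofPath_mul_of_ne _ _ (Ne.symm hl)]
  · simp

theorem mul_one' [Finite V] (f : PathAlgebra k V) : f * 1 = f := by
  have := Fintype.ofFinite V
  induction f using basis_induction with
  | zero => rw [zero_mul']
  | add a b ha hb => rw [add_mul', ha, hb]
  | smul c p =>
  obtain ⟨i, j, p⟩ := p
  rw [smul_mul', one_def, finsum_eq_sum_of_fintype, mul_def, map_sum, Finset.sum_eq_single i]
  · rw [← mul_def, ofPath_mul_comp, Quiver.Path.nil_comp]
  · intro l _ hl
    rw [← mul_def, ofPath_mul_of_ne _ _ hl]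
  · simp

end Module

section Ring

variable (k : Type u) (V : Type v) [Field k] [Quiver.{w} V] [Finite V]

instance : Ring (PathAlgebra k V) :=
  { (inferInstance : AddCommGroup (PathAlgebra k V)),
    (inferInstance : Mul (PathAlgebra k V)), (inferInstance : One (PathAlgebra k V)) with
    left_distrib := mul_add'
    right_distrib := add_mul'
    zero_mul := zero_mul'
    mul_zero := mul_zero'
    mul_assoc := mul_assoc'
    one_mul := one_mul'
    mul_one := mul_one' }

instance : Algebra k (PathAlgebra k V) := Algebra.ofModule smul_mul' mul_smul'

/-- The arrow ideal: the two-sided ideal of the path algebra generated by all arrows. -/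
def arrowIdeal : TwoSidedIdeal (PathAlgebra k V) :=
  TwoSidedIdeal.span {f | ∃ (i j : V) (α : i ⟶ j), f = ofPath k ⟨i, j, α.toPath⟩}

end Ring

end PathAlgebra

section Quiver

variable {k : Type u} {V : Type v} [Field k] [Quiver.{w} V] [Finite V]

/-- The quotient algebra `kQ/I` of the path algebra by a two-sided ideal. -/
abbrev QuiverAlgebra (I : TwoSidedIdeal (PathAlgebra k V)) : Type max u v w :=
  I.ringCon.Quotient

instance (I : TwoSidedIdeal (PathAlgebra k V)) [FiniteDimensional k (QuiverAlgebra I)] :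
    IsNoetherianRing (QuiverAlgebra I) :=
  isNoetherian_of_tower k inferInstance

end Quiver

section Glue

variable {V : Type v} [Quiver.{w} V]

/-- The vertices `x̄ = {x, E x}` of the glued quiver `Q(E)`. -/
abbrev GluedVertex (E : V → V) : Type v := Set.range fun x : V => ({x, E x} : Set V)

/-- The map `x ↦ x̄ = {x, E x}`. -/
def glueVertex (E : V → V) (x : V) : GluedVertex E := ⟨{x, E x}, x, rfl⟩

/-- The glued quiver `Q(E)`: its vertices are the sets `x̄ = {x, E x}`, and its arrows are exactly
the arrows of `Q`, an arrow `α : x ⟶ y` of `Q` being an arrow `x̄ ⟶ ȳ` of `Q(E)`. -/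
abbrev GluedQuiver (E : V → V) : Type v := Quiver.Push (glueVertex E)

instance [Finite V] (E : V → V) : Finite (GluedQuiver E) :=
  inferInstanceAs (Finite (GluedVertex E))

/-- A path of `Q`, seen as a path of `Q(E)`. -/
def gluePath (E : V → V) (p : QuiverPath V) : QuiverPath (GluedQuiver E) :=
  ⟨_, _, (Quiver.Push.of (glueVertex E)).mapPath p.path⟩

variable (k : Type u) [Field k]

/-- The `k`-linear map `kQ → kQ(E)` that sends each path of `Q` to the same path of `Q(E)`. -/
def glueMap (E : V → V) : PathAlgebra k V →ₗ[k] PathAlgebra k (GluedQuiver E) :=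
  (PathAlgebra.basis k V).constr k fun p => PathAlgebra.ofPath k (gluePath E p)

variable {k} [Finite V]

/-- The ideal `I(E)` of `kQ(E)` generated by the image of `I`. -/
def gluedIdeal (I : TwoSidedIdeal (PathAlgebra k V)) (E : V → V) :
    TwoSidedIdeal (PathAlgebra k (GluedQuiver E)) :=
  TwoSidedIdeal.span (glueMap k E '' (I : Set (PathAlgebra k V)))

end Glue

section Singularity

open CategoryTheory Limits Pretriangulated ZeroObject

namespace DerivedCategory

variable (C : Type u) [Category.{v} C] [Abelian C] [HasDerivedCategory.{w} C]

/-- The objects of the derived category of `C` that are isomorphic to (the image of) a bounded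
complex of projective objects, i.e. the essential image of `K^b(proj C)`. -/
def boundedProjective : ObjectProperty (DerivedCategory C) := fun X =>
  ∃ (K : CochainComplex C ℤ) (a b : ℤ), K.IsStrictlyGE a ∧ K.IsStrictlyLE b ∧
    (∀ n, Projective (K.X n)) ∧ Nonempty (X ≅ Q.obj K)

instance : (boundedProjective C).IsClosedUnderIsomorphisms where
  of_iso := by
    rintro X Y e ⟨K, a, b, h1, h2, h3, ⟨e'⟩⟩
    exact ⟨K, a, b, h1, h2, h3, ⟨e.symm ≪≫ e'⟩⟩

instance : (boundedProjective C).ContainsZero where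
  exists_zero := by
    refine ⟨0, isZero_zero _, 0, 0, 0, ?_, ?_, fun n => ?_, ⟨?_⟩⟩
    · rw [CochainComplex.isStrictlyGE_iff]
      exact fun i _ => (HomologicalComplex.eval C _ i).map_isZero (isZero_zero _)
    · rw [CochainComplex.isStrictlyLE_iff]
      exact fun i _ => (HomologicalComplex.eval C _ i).map_isZero (isZero_zero _)
    · exact ((HomologicalComplex.eval C _ n).map_isZero (isZero_zero _)).projective
    · exact (Q.map_isZero (isZero_zero _)).isoZero.symm

instance : (boundedProjective C).IsStableUnderShift ℤ where
  isStableUnderShiftBy n :=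
    { le_shift := by
        rintro X ⟨K, a, b, h1, h2, h3, ⟨e⟩⟩
        exact ⟨K⟦n⟧, a - n, b - n, K.isStrictlyGE_shift a n _ (by omega),
          K.isStrictlyLE_shift b n _ (by omega), fun i => h3 (i + n),
          ⟨(shiftFunctor _ n).mapIso e ≪≫ (Q.commShiftIso n).symm.app K⟩⟩ }

instance : (boundedProjective C).IsTriangulatedClosed₃ := .mk' (by
    rintro T hT ⟨K, a, b, h1, h2, h3, ⟨e⟩⟩ ⟨L, a', b', h1', h2', h3', ⟨e'⟩⟩
    have := CochainComplex.isKProjective_of_projective K b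
    obtain ⟨g, hg⟩ := (CochainComplex.IsKProjective.Qh_map_bijective K
      ((HomotopyCategory.quotient _ _).obj L)).2
        ((quotientCompQhIso C).hom.app K ≫ e.inv ≫ T.mor₁ ≫ e'.hom ≫
          (quotientCompQhIso C).inv.app L)
    obtain ⟨f, rfl⟩ := (HomotopyCategory.quotient _ _).map_surjective g
    have hf : Q.map f = e.inv ≫ T.mor₁ ≫ e'.hom := by
      rw [← cancel_epi ((quotientCompQhIso C).hom.app K), ← quotientCompQhIso_hom_naturality, hg]
      simp
    have hcone : Q.mapTriangle.obj (CochainComplex.mappingCone.triangle f) ∈ distTriang _ := by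
      rw [mem_distTriang_iff]
      exact ⟨_, _, f, ⟨Iso.refl _⟩⟩
    let iso := isoTriangleOfIso₁₂ T _ hT hcone e e' (by
      change T.mor₁ ≫ e'.hom = e.hom ≫ Q.map f
      rw [hf, Iso.hom_inv_id_assoc])
    refine ⟨CochainComplex.mappingCone f, min (a - 1) a', max b b', ?_, ?_, fun n => ?_,
      ⟨Triangle.π₃.mapIso iso⟩⟩
    · rw [CochainComplex.isStrictlyGE_iff]
      intro i hi
      rw [CochainComplex.mappingCone.isZero_X_iff]
      exact ⟨K.isZero_of_isStrictlyGE a _ (by omega), L.isZero_of_isStrictlyGE a' _ (by omega)⟩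
    · rw [CochainComplex.isStrictlyLE_iff]
      intro i hi
      rw [CochainComplex.mappingCone.isZero_X_iff]
      exact ⟨K.isZero_of_isStrictlyLE b _ (by omega), L.isZero_of_isStrictlyLE b' _ (by omega)⟩
    · exact Projective.of_iso (HomologicalComplex.homotopyCofiber.XIsoBiprod f n (n + 1) rfl).symm
        inferInstance)

instance : (boundedProjective C).IsTriangulated where
  toIsTriangulatedClosed₂ := .of_isTriangulatedClosed₃

end DerivedCategory

/-- `K^b(proj C)` as a full (replete, triangulated) subcategory of the bounded derived category
`D^b(C)`. -/
abbrev boundedProjective (C : Type u) [Category.{v} C] [Abelian C] [HasDerivedCategory.{w} C] :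
    ObjectProperty (DerivedCategory.Bounded C) :=
  (DerivedCategory.boundedProjective C).inverseImage DerivedCategory.Bounded.ι

/-- The singularity category `D_sg(A) = D^b(mod A) / K^b(proj A)` of a left noetherian ring `A`:
the Verdier quotient, i.e. the localization of `D^b(mod A)` at the morphisms whose cone lies in
`K^b(proj A)`. Here `mod A` is the category of finitely generated left `A`-modules, whose
projective objects are the finitely generated projective modules. -/
abbrev SingularityCategory (A : Type u) [Ring A] [IsNoetherianRing A]
    [HasDerivedCategory.{w} (FGModuleCat.{u} A)] :=
  (boundedProjective (FGModuleCat.{u} A)).trW.Localization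

/-- Two triangulated categories are triangle equivalent if there is an equivalence between them
that commutes with the shifts and sends distinguished triangles to distinguished triangles. -/
def TriangleEquivalent (C D : Type*) [Category* C] [Category* D]
    [HasShift C ℤ] [HasShift D ℤ] [HasZeroObject C] [HasZeroObject D]
    [Preadditive C] [Preadditive D]
    [∀ n : ℤ, (shiftFunctor C n).Additive] [∀ n : ℤ, (shiftFunctor D n).Additive]
    [Pretriangulated C] [Pretriangulated D] : Prop :=
  ∃ (F : C ⥤ D) (_ : F.CommShift ℤ), F.IsEquivalence ∧ F.IsTriangulated

/-- Two left noetherian rings are singularity equivalent if their singularity categories are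
triangle equivalent. -/
def SingularityEquivalent (A : Type u) (B : Type v) [Ring A] [Ring B]
    [IsNoetherianRing A] [IsNoetherianRing B]
    [HasDerivedCategory.{w} (FGModuleCat.{u} A)] [HasDerivedCategory.{w'} (FGModuleCat.{v} B)] :
    Prop :=
  TriangleEquivalent (SingularityCategory A) (SingularityCategory B)

end Singularity

end

/-!
The gluing `Λ = S_E` of `S = kQ/I` is described by a universal property which does not mention
quivers (`GluedAlgebra`): there is a linear map `γ : S → Λ`, multiplicative on products through one
idempotent `e x`, which identifies `e x` with `e (E x)`, and it is universal. Hence a `Λ`-module is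
the same thing as an `S`-module with a swap, i.e. an involution `θ` that identifies `e x W` with
`e (E x) W` and is the identity on `e x W` if `E x = x` (`Fixed.equivPullback`,
`Pullback.exists_map_eq`). Forgetting the swap is a faithful exact functor `G : mod Λ → mod S`. It
has a left adjoint `F`, and the equivalence of singularity categories is induced by `F`.

By `triangleEquivalent_of_faithful` it suffices that `F` is exact, that the unit `N → G F N` is
injective with projective cokernel, and that the counit `F G X → X` has a projective kernel. Then
`F` and `G` are exact and preserve projectives, and on singularity categories unit and counit become
isomorphisms, because a degreewise injection (surjection) of bounded complexes with projective
cokernels (kernels) has a perfect cone.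

The module `G F N` is constructed as in a free product: it is the sum of `N` and of copies of
projective modules `S e_z`, indexed by alternating words in basis elements of `N` and of the modules
`S e_z` (`Letter`, `Induced`). So the unit is a split injection with projective cokernel
(`Ind.projective_quotient_range_unit`). As `Λ` is finite-dimensional, there are finitely many words,
and the dimension of `G F N` is the sum of numbers `wordCount x` over the degrees `x` of a
homogeneous basis of `N` (`Ind.finrank_pullback`). This number is additive in short exact sequences,
so the right exact functor `F` is exact (`Ind.injective_of_injective`).

For the counit, `F G X → X` is the quotient by the relations `θ [y] = [θ y]`, where `[y]` denotes
the image of `y` under the unit, and where it suffices that `y` runs through a basis of the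
components at representatives `z` of the orbits of length two. Each relation is an image of the generator of
`S e_{E z}`, so the kernel is a quotient of `F P` for a projective module `P` (`Relations`). The
recursion `wordCount_eq` shows that the dimensions agree (`finrank_pullback_relations`), so the
kernel is isomorphic to `F P` and projective (`projective_ker_counit`).
-/

noncomputable section

/-! ### Triangle equivalences of singularity categories from adjunctions -/

section ExactAdjunction

open CategoryTheory Limits Pretriangulated ZeroObject

universe w₁ w₂ v₁ v₂ u₁ u₂

variable {C : Type u₁} {D : Type u₂} [Category.{v₁} C] [Category.{v₂} D] [Abelian C] [Abelian D]

section

variable {F : C ⥤ D} {G : D ⥤ C} [F.Additive] [G.Additive]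

/-- An adjunction between additive functors extends to complexes, degree by degree. -/
def complexAdjunction (adj : F ⊣ G) :
    F.mapHomologicalComplex (ComplexShape.up ℤ) ⊣ G.mapHomologicalComplex (ComplexShape.up ℤ) where
  unit :=
    { app := fun K =>
          { f := fun i => adj.unit.app (K.X i)
            comm' := fun i j _ => (adj.unit.naturality (K.d i j)).symm }
      naturality := fun K L f => by ext i; exact adj.unit.naturality (f.f i) }
  counit :=
    { app := fun K =>
          { f := fun i => adj.counit.app (K.X i)
            comm' := fun i j _ => (adj.counit.naturality (K.d i j)).symm }
      naturality := fun K L f => by ext i; exact adj.counit.naturality (f.f i) }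
  left_triangle_components := fun K => by
    ext i; exact adj.left_triangle_components (K.X i)
  right_triangle_components := fun K => by
    ext i; exact adj.right_triangle_components (K.X i)

end

section

variable (F : C ⥤ D) [F.Additive]

lemma isStrictlyGE_mapHomologicalComplex (K : CochainComplex C ℤ) (a : ℤ) (h : K.IsStrictlyGE a) :
    CochainComplex.IsStrictlyGE ((F.mapHomologicalComplex (ComplexShape.up ℤ)).obj K) a := by
  rw [CochainComplex.isStrictlyGE_iff] at h ⊢
  exact fun i hi => F.map_isZero (h i hi)

lemma isStrictlyLE_mapHomologicalComplex (K : CochainComplex C ℤ) (a : ℤ) (h : K.IsStrictlyLE a) :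
    CochainComplex.IsStrictlyLE ((F.mapHomologicalComplex (ComplexShape.up ℤ)).obj K) a := by
  rw [CochainComplex.isStrictlyLE_iff] at h ⊢
  exact fun i hi => F.map_isZero (h i hi)

end

section

variable [HasDerivedCategory.{w₁} C] [HasDerivedCategory.{w₂} D]

/-- Bounded objects of the derived category are represented by bounded complexes. -/
lemma DerivedCategory.bounded_iff (X : DerivedCategory C) :
    DerivedCategory.TStructure.t.bounded X ↔
      ∃ (K : CochainComplex C ℤ) (a b : ℤ), K.IsStrictlyGE a ∧ K.IsStrictlyLE b ∧
        Nonempty (X ≅ DerivedCategory.Q.obj K) := by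
  constructor
  · rintro ⟨⟨a, ha⟩, ⟨b, hb⟩⟩
    obtain ⟨K, h₁, h₂, e⟩ := DerivedCategory.exists_iso_Q_obj_of_isGE_of_isLE X a b
    exact ⟨K, a, b, h₁, h₂, e⟩
  · rintro ⟨K, a, b, h₁, h₂, ⟨e⟩⟩
    refine ObjectProperty.prop_of_iso _ e.symm ⟨⟨a, ?_⟩, ⟨b, ?_⟩⟩
    · exact (inferInstance : (DerivedCategory.Q.obj K).IsGE a)
    · exact (inferInstance : (DerivedCategory.Q.obj K).IsLE b)

variable (F : C ⥤ D) [F.Additive]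

variable [PreservesFiniteLimits F] [PreservesFiniteColimits F]

lemma bounded_mapDerivedCategory (X : DerivedCategory C)
    (hX : DerivedCategory.TStructure.t.bounded X) :
    DerivedCategory.TStructure.t.bounded (F.mapDerivedCategory.obj X) := by
  rw [DerivedCategory.bounded_iff] at hX ⊢
  obtain ⟨K, a, b, h₁, h₂, ⟨e⟩⟩ := hX
  exact ⟨_, a, b, isStrictlyGE_mapHomologicalComplex F K a h₁,
    isStrictlyLE_mapHomologicalComplex F K b h₂,
    ⟨F.mapDerivedCategory.mapIso e ≪≫ F.mapDerivedCategoryFactors.app K⟩⟩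

lemma boundedProjective_mapDerivedCategory [F.PreservesProjectiveObjects] (X : DerivedCategory C)
    (hX : DerivedCategory.boundedProjective C X) :
    DerivedCategory.boundedProjective D (F.mapDerivedCategory.obj X) := by
  obtain ⟨K, a, b, h₁, h₂, h₃, ⟨e⟩⟩ := hX
  exact ⟨_, a, b, isStrictlyGE_mapHomologicalComplex F K a h₁,
    isStrictlyLE_mapHomologicalComplex F K b h₂,
    fun n => F.projective_obj_of_projective (h₃ n),
    ⟨F.mapDerivedCategory.mapIso e ≪≫ F.mapDerivedCategoryFactors.app K⟩⟩

/-- The functor between bounded derived categories induced by an exact functor. -/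
def boundedFunctor : DerivedCategory.Bounded C ⥤ DerivedCategory.Bounded D :=
  DerivedCategory.TStructure.t.bounded.lift (DerivedCategory.Bounded.ι ⋙ F.mapDerivedCategory)
    fun X => bounded_mapDerivedCategory F X.obj X.property

/-- The functor `boundedFunctor F` is a restriction of `F.mapDerivedCategory`. -/
def boundedFunctorCompι :
    boundedFunctor F ⋙ DerivedCategory.Bounded.ι ≅
      DerivedCategory.Bounded.ι ⋙ F.mapDerivedCategory :=
  ObjectProperty.liftCompιIso _ _ _

instance : (boundedFunctor F).CommShift ℤ :=
  inferInstanceAs ((DerivedCategory.TStructure.t.bounded.lift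
    (DerivedCategory.Bounded.ι ⋙ F.mapDerivedCategory)
    fun X => bounded_mapDerivedCategory F X.obj X.property).CommShift ℤ)

instance : (boundedFunctor F).IsTriangulated :=
  ObjectProperty.isTriangulated_lift DerivedCategory.TStructure.t.bounded
    (DerivedCategory.Bounded.ι ⋙ F.mapDerivedCategory)
    fun X => bounded_mapDerivedCategory F X.obj X.property

instance (A : Type*) [Category* A] [Abelian A] [HasDerivedCategory A] :
    (boundedProjective A).IsTriangulated := by
  unfold boundedProjective; infer_instance

lemma trW_boundedFunctor [F.PreservesProjectiveObjects] {X Y : DerivedCategory.Bounded C}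
    (f : X ⟶ Y) (hf : (boundedProjective C).trW f) :
    (boundedProjective D).trW ((boundedFunctor F).map f) := by
  obtain ⟨Z, g, h, hT, hZ⟩ := hf
  have hZ' : boundedProjective D ((boundedFunctor F).obj Z) :=
    boundedProjective_mapDerivedCategory F Z.obj hZ
  exact ObjectProperty.trW.mk _ ((boundedFunctor F).map_distinguished _ hT) hZ'

/-- The functor between Verdier quotients `D^b / K^b(proj)` induced by an exact functor which
preserves projective objects. -/
def singularityFunctor [F.PreservesProjectiveObjects] :
    (boundedProjective C).trW.Localization ⥤ (boundedProjective D).trW.Localization :=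
  Localization.lift (boundedFunctor F ⋙ (boundedProjective D).trW.Q)
    (fun _ _ f hf => Localization.inverts (boundedProjective D).trW.Q (boundedProjective D).trW _
      (trW_boundedFunctor F f hf))
    (boundedProjective C).trW.Q

instance [F.PreservesProjectiveObjects] :
    Localization.Lifting (boundedProjective C).trW.Q (boundedProjective C).trW
      (boundedFunctor F ⋙ (boundedProjective D).trW.Q) (singularityFunctor F) :=
  ⟨Localization.fac _ _ _⟩

instance [F.PreservesProjectiveObjects] : (singularityFunctor F).CommShift ℤ :=
  Functor.commShiftOfLocalization (boundedProjective C).trW.Q (boundedProjective C).trW ℤ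
    (boundedFunctor F ⋙ (boundedProjective D).trW.Q) _

instance [F.PreservesProjectiveObjects] : (singularityFunctor F).IsTriangulated := by
  have : NatTrans.CommShift (Localization.Lifting.iso (boundedProjective C).trW.Q
      (boundedProjective C).trW (boundedFunctor F ⋙ (boundedProjective D).trW.Q)
      (singularityFunctor F)).hom ℤ :=
    NatTrans.commShift_iso_hom_of_localization _ _ _ _ _
  have : (boundedProjective C).trW.Q.mapArrow.EssSurj :=
    Localization.essSurj_mapArrow _ (boundedProjective C).trW
  exact Functor.isTriangulated_of_precomp_iso
    (Localization.Lifting.iso (boundedProjective C).trW.Q (boundedProjective C).trW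
      (boundedFunctor F ⋙ (boundedProjective D).trW.Q) (singularityFunctor F))

end

section

variable [HasDerivedCategory.{w₁} C] [HasDerivedCategory.{w₂} D]
variable {F : C ⥤ D} {G : D ⥤ C} [F.Additive] [G.Additive]
  [PreservesFiniteLimits F] [PreservesFiniteColimits F]
  [PreservesFiniteLimits G] [PreservesFiniteColimits G]

instance catCommSqDerived : CatCommSq (F.mapHomologicalComplex (ComplexShape.up ℤ))
    (DerivedCategory.Q (C := C)) (DerivedCategory.Q (C := D)) F.mapDerivedCategory :=
  ⟨F.mapDerivedCategoryFactors.symm⟩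

instance catCommSqSingularity [F.PreservesProjectiveObjects] :
    CatCommSq (boundedFunctor F) (boundedProjective C).trW.Q (boundedProjective D).trW.Q
      (singularityFunctor F) :=
  ⟨(Localization.Lifting.iso (boundedProjective C).trW.Q (boundedProjective C).trW
      (boundedFunctor F ⋙ (boundedProjective D).trW.Q) (singularityFunctor F)).symm⟩

/-- The adjunction between derived categories induced by an adjunction of exact functors. -/
def derivedAdjunction (adj : F ⊣ G) : F.mapDerivedCategory ⊣ G.mapDerivedCategory :=
  (complexAdjunction adj).localization DerivedCategory.Q
    (HomologicalComplex.quasiIso C (ComplexShape.up ℤ)) DerivedCategory.Q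
    (HomologicalComplex.quasiIso D (ComplexShape.up ℤ)) _ _

/-- The adjunction between bounded derived categories induced by an adjunction of exact
functors. -/
def boundedAdjunction (adj : F ⊣ G) : boundedFunctor F ⊣ boundedFunctor G :=
  (derivedAdjunction adj).restrictFullyFaithful
    (DerivedCategory.TStructure.t.bounded.fullyFaithfulι)
    (DerivedCategory.TStructure.t.bounded.fullyFaithfulι)
    (boundedFunctorCompι F).symm (boundedFunctorCompι G).symm

/-- The adjunction between singularity categories induced by an adjunction of exact functors
which preserve projective objects. -/
def singularityAdjunction [F.PreservesProjectiveObjects] [G.PreservesProjectiveObjects]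
    (adj : F ⊣ G) : singularityFunctor F ⊣ singularityFunctor G :=
  (boundedAdjunction adj).localization (boundedProjective C).trW.Q (boundedProjective C).trW
    (boundedProjective D).trW.Q (boundedProjective D).trW _ _

/-- The image in the derived category of a degreewise monomorphism between bounded complexes
with projective cokernels becomes invertible in the singularity category. -/
lemma trW_Q_map_of_mono {K L : CochainComplex C ℤ} (f : K ⟶ L) (a b : ℤ)
    (ha : L.IsStrictlyGE a) (hb : L.IsStrictlyLE b) (h : ∀ n, Mono (f.f n))
    (h' : ∀ n, Projective (cokernel (f.f n))) :
    (DerivedCategory.boundedProjective C).trW (DerivedCategory.Q.map f) := by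
  have : Mono f := HomologicalComplex.mono_of_mono_f f h
  have hS : (ShortComplex.mk f (cokernel.π f) (cokernel.condition f)).ShortExact :=
    { exact := ShortComplex.exact_of_g_is_cokernel _ (cokernelIsCokernel f) }
  have e (n : ℤ) : (cokernel f).X n ≅ cokernel (f.f n) :=
    PreservesCokernel.iso (HomologicalComplex.eval C (ComplexShape.up ℤ) n) f
  have hepi (n : ℤ) : Epi ((cokernel.π f).f n) :=
    inferInstanceAs (Epi ((HomologicalComplex.eval C (ComplexShape.up ℤ) n).map (cokernel.π f)))
  rw [CochainComplex.isStrictlyGE_iff] at ha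
  rw [CochainComplex.isStrictlyLE_iff] at hb
  exact ObjectProperty.trW.mk _ (DerivedCategory.triangleOfSES_distinguished hS)
    ⟨cokernel f, a, b,
      (CochainComplex.isStrictlyGE_iff _ _).2 fun i hi =>
        IsZero.of_epi ((cokernel.π f).f i) (ha i hi),
      (CochainComplex.isStrictlyLE_iff _ _).2 fun i hi =>
        IsZero.of_epi ((cokernel.π f).f i) (hb i hi),
      fun n => Projective.of_iso (e n).symm (h' n), ⟨Iso.refl _⟩⟩

/-- The image in the derived category of a degreewise epimorphism between bounded complexes
with projective kernels becomes invertible in the singularity category. -/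
lemma trW_Q_map_of_epi {K L : CochainComplex C ℤ} (f : K ⟶ L) (a b : ℤ)
    (ha : K.IsStrictlyGE a) (hb : K.IsStrictlyLE b) (h : ∀ n, Epi (f.f n))
    (h' : ∀ n, Projective (kernel (f.f n))) :
    (DerivedCategory.boundedProjective C).trW (DerivedCategory.Q.map f) := by
  have : Epi f := HomologicalComplex.epi_of_epi_f f h
  have hS : (ShortComplex.mk (kernel.ι f) f (kernel.condition f)).ShortExact :=
    { exact := ShortComplex.exact_of_f_is_kernel _ (kernelIsKernel f) }
  have e (n : ℤ) : (kernel f).X n ≅ kernel (f.f n) :=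
    PreservesKernel.iso (HomologicalComplex.eval C (ComplexShape.up ℤ) n) f
  have hmono (n : ℤ) : Mono ((kernel.ι f).f n) :=
    inferInstanceAs (Mono ((HomologicalComplex.eval C (ComplexShape.up ℤ) n).map (kernel.ι f)))
  rw [CochainComplex.isStrictlyGE_iff] at ha
  rw [CochainComplex.isStrictlyLE_iff] at hb
  exact ObjectProperty.trW.mk' _ (DerivedCategory.triangleOfSES_distinguished hS)
    ⟨kernel f, a, b,
      (CochainComplex.isStrictlyGE_iff _ _).2 fun i hi =>
        IsZero.of_mono ((kernel.ι f).f i) (ha i hi),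
      (CochainComplex.isStrictlyLE_iff _ _).2 fun i hi =>
        IsZero.of_mono ((kernel.ι f).f i) (hb i hi),
      fun n => Projective.of_iso (e n).symm (h' n), ⟨Iso.refl _⟩⟩

lemma mem_app_iff_of_iso {A B : Type*} [Category* A] [Category* B] (W : MorphismProperty B)
    [W.RespectsIso] {H H' : A ⥤ B} (τ : H ⟶ H') {X Y : A} (e : X ≅ Y) :
    W (τ.app X) ↔ W (τ.app Y) := by
  exact (MorphismProperty.cancel_right_of_respectsIso W (τ.app X) (H'.map e.hom)).symm.trans
    ((iff_of_eq (congrArg (fun f => W f) (τ.naturality e.hom).symm)).trans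
      (MorphismProperty.cancel_left_of_respectsIso W (H.map e.hom) (τ.app Y)))

lemma derivedAdjunction_unit_mem (adj : F ⊣ G) (h : ∀ X, Mono (adj.unit.app X))
    (h' : ∀ X, Projective (cokernel (adj.unit.app X))) (X : DerivedCategory C)
    (hX : DerivedCategory.TStructure.t.bounded X) :
    (DerivedCategory.boundedProjective C).trW ((derivedAdjunction adj).unit.app X) := by
  rw [DerivedCategory.bounded_iff] at hX
  obtain ⟨K, a, b, h₁, h₂, ⟨e⟩⟩ := hX
  refine (mem_app_iff_of_iso _ _ e).2 ?_
  rw [derivedAdjunction, Adjunction.localization_unit_app]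
  refine (MorphismProperty.cancel_right_of_respectsIso
    (DerivedCategory.boundedProjective C).trW _ _).2 ?_
  exact trW_Q_map_of_mono _ a b
    (isStrictlyGE_mapHomologicalComplex G _ a (isStrictlyGE_mapHomologicalComplex F _ a h₁))
    (isStrictlyLE_mapHomologicalComplex G _ b (isStrictlyLE_mapHomologicalComplex F _ b h₂))
    (fun n => h (K.X n)) (fun n => h' (K.X n))

lemma derivedAdjunction_counit_mem (adj : F ⊣ G) (h : ∀ X, Epi (adj.counit.app X))
    (h' : ∀ X, Projective (kernel (adj.counit.app X))) (X : DerivedCategory D)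
    (hX : DerivedCategory.TStructure.t.bounded X) :
    (DerivedCategory.boundedProjective D).trW ((derivedAdjunction adj).counit.app X) := by
  rw [DerivedCategory.bounded_iff] at hX
  obtain ⟨K, a, b, h₁, h₂, ⟨e⟩⟩ := hX
  refine (mem_app_iff_of_iso _ _ e).2 ?_
  rw [derivedAdjunction, Adjunction.localization_counit_app]
  refine (MorphismProperty.cancel_left_of_respectsIso
    (DerivedCategory.boundedProjective D).trW _ _).2 ?_
  refine (MorphismProperty.cancel_left_of_respectsIso
    (DerivedCategory.boundedProjective D).trW _ _).2 ?_
  exact trW_Q_map_of_epi _ a b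
    (isStrictlyGE_mapHomologicalComplex F _ a (isStrictlyGE_mapHomologicalComplex G _ a h₁))
    (isStrictlyLE_mapHomologicalComplex F _ b (isStrictlyLE_mapHomologicalComplex G _ b h₂))
    (fun n => h (K.X n)) (fun n => h' (K.X n))

lemma trW_bounded_iff {X Y : DerivedCategory.Bounded C} (f : X ⟶ Y) :
    (boundedProjective C).trW f ↔ (DerivedCategory.boundedProjective C).trW f.hom :=
  (DerivedCategory.boundedProjective C).inverseImage_trW_iff DerivedCategory.Bounded.ι f

lemma boundedAdjunction_unit_mem (adj : F ⊣ G) (h : ∀ X, Mono (adj.unit.app X))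
    (h' : ∀ X, Projective (cokernel (adj.unit.app X))) (X : DerivedCategory.Bounded C) :
    (boundedProjective C).trW ((boundedAdjunction adj).unit.app X) := by
  rw [trW_bounded_iff]
  have := derivedAdjunction_unit_mem adj h h' X.obj X.property
  have eq : ((boundedAdjunction adj).unit.app X).hom = _ :=
    (derivedAdjunction adj).map_restrictFullyFaithful_unit_app
      (DerivedCategory.TStructure.t.bounded.fullyFaithfulι)
      (DerivedCategory.TStructure.t.bounded.fullyFaithfulι)
      (boundedFunctorCompι F).symm (boundedFunctorCompι G).symm X
  rw [eq]
  exact (MorphismProperty.cancel_right_of_respectsIso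
    (DerivedCategory.boundedProjective C).trW _ _).2 this

lemma boundedAdjunction_counit_mem (adj : F ⊣ G) (h : ∀ X, Epi (adj.counit.app X))
    (h' : ∀ X, Projective (kernel (adj.counit.app X))) (X : DerivedCategory.Bounded D) :
    (boundedProjective D).trW ((boundedAdjunction adj).counit.app X) := by
  rw [trW_bounded_iff]
  have := derivedAdjunction_counit_mem adj h h' X.obj X.property
  have eq : ((boundedAdjunction adj).counit.app X).hom = _ :=
    (derivedAdjunction adj).map_restrictFullyFaithful_counit_app
      (DerivedCategory.TStructure.t.bounded.fullyFaithfulι)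
      (DerivedCategory.TStructure.t.bounded.fullyFaithfulι)
      (boundedFunctorCompι F).symm (boundedFunctorCompι G).symm X
  rw [eq]
  exact (MorphismProperty.cancel_left_of_respectsIso _ _ _).2
    ((MorphismProperty.cancel_left_of_respectsIso
      (DerivedCategory.boundedProjective D).trW _ _).2 this)

/-- An adjunction between exact functors that preserve projective objects, whose unit is a
monomorphism with projective cokernel and whose counit is an epimorphism with projective kernel,
induces a triangle equivalence of the Verdier quotients `D^b / K^b(proj)`. -/
theorem triangleEquivalent_of_adjunction [F.PreservesProjectiveObjects]
    [G.PreservesProjectiveObjects] (adj : F ⊣ G)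
    (h₁ : ∀ X, Mono (adj.unit.app X)) (h₂ : ∀ X, Projective (cokernel (adj.unit.app X)))
    (h₃ : ∀ X, Epi (adj.counit.app X)) (h₄ : ∀ X, Projective (kernel (adj.counit.app X))) :
    TriangleEquivalent (boundedProjective C).trW.Localization
      (boundedProjective D).trW.Localization := by
  refine ⟨singularityFunctor F, inferInstance, ?_, inferInstance⟩
  let sadj := singularityAdjunction adj
  have hC (X : (boundedProjective C).trW.Localization) : IsIso (sadj.unit.app X) := by
    have : (boundedProjective C).trW.Q.EssSurj :=
      Localization.essSurj _ (boundedProjective C).trW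
    rw [← NatTrans.isIso_app_iff_of_iso sadj.unit ((boundedProjective C).trW.Q.objObjPreimageIso X)]
    have := Localization.inverts (boundedProjective C).trW.Q (boundedProjective C).trW _
      (boundedAdjunction_unit_mem adj h₁ h₂ ((boundedProjective C).trW.Q.objPreimage X))
    dsimp only [sadj, singularityAdjunction]
    rw [Adjunction.localization_unit_app]
    infer_instance
  have hD (X : (boundedProjective D).trW.Localization) : IsIso (sadj.counit.app X) := by
    have : (boundedProjective D).trW.Q.EssSurj :=
      Localization.essSurj _ (boundedProjective D).trW
    rw [← NatTrans.isIso_app_iff_of_iso sadj.counit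
      ((boundedProjective D).trW.Q.objObjPreimageIso X)]
    have := Localization.inverts (boundedProjective D).trW.Q (boundedProjective D).trW _
      (boundedAdjunction_counit_mem adj h₃ h₄ ((boundedProjective D).trW.Q.objPreimage X))
    dsimp only [sadj, singularityAdjunction]
    rw [Adjunction.localization_counit_app]
    infer_instance
  exact sadj.toEquivalence.isEquivalence_functor

end

end ExactAdjunction

/-! ### Faithful right adjoints -/

section FaithfulExactAdjunction

open CategoryTheory Limits Pretriangulated ZeroObject

universe w₁ w₂ v₁ v₂ u₁ u₂

variable {C : Type u₁} {D : Type u₂} [Category.{v₁} C] [Category.{v₂} D] [Abelian C] [Abelian D]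
  {F : C ⥤ D} {G : D ⥤ C}

lemma projective_of_mono_of_projective_cokernel {X Y : C} (f : X ⟶ Y) [Mono f] (hX : Projective X)
    (h : Projective (cokernel f)) : Projective Y := by
  have hS : (ShortComplex.mk f (cokernel.π f) (cokernel.condition f)).ShortExact :=
    { exact := ShortComplex.exact_of_g_is_cokernel _ (cokernelIsCokernel f) }
  have : Projective (ShortComplex.mk f (cokernel.π f) (cokernel.condition f)).X₃ := h
  exact Projective.of_iso hS.splittingOfProjective.isoBinaryBiproduct.symm inferInstance

omit [Abelian D] in
/-- A faithful right adjoint `G` preserves projective objects when the unit is a monomorphism with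
projective cokernel: a projective object `X` is a retract of `F P` for a projective `P`
covering `G X`, and `G F P` is an extension of projective objects. -/
lemma preservesProjectiveObjects_of_unit [EnoughProjectives C]
    [G.Faithful] (adj : F ⊣ G) (h₁ : ∀ X, Mono (adj.unit.app X))
    (h₂ : ∀ X, Projective (cokernel (adj.unit.app X))) : G.PreservesProjectiveObjects where
  projective_obj {X} hX := by
    have : F.IsLeftAdjoint := adj.isLeftAdjoint
    obtain ⟨r, hr⟩ := Projective.factors (𝟙 X)
      (F.map (Projective.π (G.obj X)) ≫ adj.counit.app X)
    have hP : Projective (G.obj (F.obj (Projective.over (G.obj X)))) :=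
      projective_of_mono_of_projective_cokernel
        (adj.unit.app (Projective.over (G.obj X))) inferInstance (h₂ _)
    exact Retract.projective (p := hP)
      { i := G.map r
        r := G.map (F.map (Projective.π (G.obj X)) ≫ adj.counit.app X)
        retract := by rw [← G.map_comp, hr, G.map_id] }

lemma preservesFiniteLimits_of_preservesMonomorphisms [F.Additive] [PreservesFiniteColimits F]
    [F.PreservesMonomorphisms] : PreservesFiniteLimits F := by
  rw [Functor.preservesFiniteLimits_iff_forall_exact_map_and_mono]
  refine fun S hS => ⟨?_, ?_⟩
  · exact ((Functor.preservesFiniteColimits_iff_forall_exact_map_and_epi F).1 inferInstance S hS).1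
  · have := hS.mono_f
    exact inferInstanceAs (Mono (F.map S.f))

lemma preservesFiniteColimits_of_preservesEpimorphisms [G.Additive] [PreservesFiniteLimits G]
    [G.PreservesEpimorphisms] : PreservesFiniteColimits G := by
  rw [Functor.preservesFiniteColimits_iff_forall_exact_map_and_epi]
  refine fun S hS => ⟨?_, ?_⟩
  · exact ((Functor.preservesFiniteLimits_iff_forall_exact_map_and_mono G).1 inferInstance S hS).1
  · have := hS.epi_g
    exact inferInstanceAs (Epi (G.map S.g))

/-- Let `F ⊣ G` with `G` faithful and preserving epimorphisms, and `F` preserving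
monomorphisms. If the unit is a monomorphism with projective cokernel and the counit has projective
kernels, then `D^b / K^b(proj)` is the same for both categories. -/
theorem triangleEquivalent_of_faithful [HasDerivedCategory.{w₁} C] [HasDerivedCategory.{w₂} D]
    [EnoughProjectives C] (adj : F ⊣ G) [G.Additive] [G.PreservesEpimorphisms] [G.Faithful]
    [F.PreservesMonomorphisms]
    (h₁ : ∀ X, Mono (adj.unit.app X)) (h₂ : ∀ X, Projective (cokernel (adj.unit.app X)))
    (h₃ : ∀ X, Projective (kernel (adj.counit.app X))) :
    TriangleEquivalent (boundedProjective C).trW.Localization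
      (boundedProjective D).trW.Localization := by
  have : F.Additive := adj.left_adjoint_additive
  have : PreservesFiniteLimits G := adj.rightAdjoint_preservesLimits.{0, 0}.preservesFiniteLimits
  have : PreservesFiniteColimits G := preservesFiniteColimits_of_preservesEpimorphisms
  have : PreservesFiniteColimits F :=
    adj.leftAdjoint_preservesColimits.{0, 0}.preservesFiniteColimits
  have : PreservesFiniteLimits F := preservesFiniteLimits_of_preservesMonomorphisms
  have := preservesProjectiveObjects_of_unit adj h₁ h₂
  have : F.PreservesProjectiveObjects :=
    Functor.preservesProjectiveObjects_of_adjunction_of_preservesEpimorphisms adj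
  exact triangleEquivalent_of_adjunction adj h₁ h₂ (fun X => inferInstance) h₃

end FaithfulExactAdjunction

/-! ### Gluings of algebras and the pullback of modules -/

/-- The gluing `Λ` of a `k`-algebra `S` along an involution `E` of the index set `V` of a complete
family `e` of orthogonal idempotents of `S`, given by its universal property. The type `O` stands
for the set of orbits of `E`, with orbit map `q` and a chosen section `r`. The linear map
`γ : S → Λ` is multiplicative on products that factor through the same `e x`, and it sends `e x`
and `e (E x)` to the same idempotent. -/
structure GluedAlgebra (k : Type v) (S Λ V O : Type u) [Field k] [Ring S] [Algebra k S] [Ring Λ]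
    [Algebra k Λ] [Fintype V] [Fintype O] where
  /-- the idempotents of `S` -/
  e : V → S
  complete : CompleteOrthogonalIdempotents e
  e_ne_zero : ∀ x, e x ≠ 0
  /-- the involution of the set of idempotents -/
  E : V → V
  involutive : Function.Involutive E
  /-- the orbit map -/
  q : V → O
  q_eq_iff : ∀ x y, q x = q y ↔ x = y ∨ x = E y
  /-- a choice of a representative in each orbit -/
  r : O → V
  q_r : ∀ o, q (r o) = o
  /-- the universal map -/
  γ : S →ₗ[k] Λ
  γ_mul : ∀ s t x, γ (s * e x) * γ (e x * t) = γ (s * e x * t)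
  γ_E : ∀ x, γ (e (E x)) = γ (e x)
  γ_orthogonal : ∀ x y, q x ≠ q y → γ (e x) * γ (e y) = 0
  γ_sum : ∑ o, γ (e (r o)) = 1
  γ_adjoin : Algebra.adjoin k (Set.range γ) = ⊤
  exists_lift : ∀ {A : Type u} [Ring A] [Algebra k A] (γ' : S →ₗ[k] A),
    (∀ s t x, γ' (s * e x) * γ' (e x * t) = γ' (s * e x * t)) →
    (∀ x, γ' (e (E x)) = γ' (e x)) → (∀ x y, q x ≠ q y → γ' (e x) * γ' (e y) = 0) →
    (∑ o, γ' (e (r o)) = 1) → ∃ Φ : Λ →ₐ[k] A, ∀ s, Φ (γ s) = γ' s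

namespace GluedAlgebra

variable {k : Type v} {S Λ V O : Type u} [Field k] [Ring S] [Algebra k S] [Ring Λ]
    [Algebra k Λ] [Fintype V] [Fintype O] (D : GluedAlgebra k S Λ V O)

lemma e_mul_self (x : V) : D.e x * D.e x = D.e x := D.complete.idem x

lemma e_mul_of_ne {x y : V} (h : x ≠ y) : D.e x * D.e y = 0 := D.complete.ortho h

lemma q_E (x : V) : D.q (D.E x) = D.q x := (D.q_eq_iff _ _).2 (Or.inr rfl)

lemma E_E (x : V) : D.E (D.E x) = x := D.involutive x

lemma E_ne_iff {x : V} : D.E (D.E x) ≠ D.E x ↔ D.E x ≠ x := by rw [E_E, ne_comm]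

lemma γ_e_eq {x y : V} (h : D.q x = D.q y) : D.γ (D.e x) = D.γ (D.e y) := by
  obtain rfl | rfl := (D.q_eq_iff _ _).1 h
  · rfl
  · exact D.γ_E y

lemma γ_e_mul_self (x : V) : D.γ (D.e x) * D.γ (D.e x) = D.γ (D.e x) := by
  have := D.γ_mul (D.e x) (D.e x) x
  simpa only [e_mul_self] using this

lemma γ_e_mul (x : V) (s : S) : D.γ (D.e x) * D.γ (D.e x * s) = D.γ (D.e x * s) := by
  have := D.γ_mul (D.e x) s x
  simpa only [e_mul_self] using this

lemma γ_mul_e (x : V) (s : S) : D.γ (s * D.e x) * D.γ (D.e x) = D.γ (s * D.e x) := by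
  have := D.γ_mul s (D.e x) x
  simpa only [e_mul_self, mul_assoc] using this

lemma γ_mul_sandwich (x y z : V) (s t : S) :
    D.γ (D.e z * s * D.e y) * D.γ (D.e y * t * D.e x) = D.γ (D.e z * s * D.e y * t * D.e x) := by
  have := D.γ_mul (D.e z * s) (t * D.e x) y
  simpa only [mul_assoc] using this

lemma sum_e : ∑ x, D.e x = 1 := D.complete.complete

section SModule

variable {W : Type*} [AddCommGroup W] [Module S W]

lemma sum_e_smul (w : W) : ∑ x, D.e x • w = w := by
  rw [← Finset.sum_smul, sum_e, one_smul]

lemma e_smul_self (x : V) (w : W) : D.e x • D.e x • w = D.e x • w := by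
  rw [smul_smul, e_mul_self]

lemma e_smul_of_ne {x y : V} (h : x ≠ y) (w : W) : D.e x • D.e y • w = 0 := by
  rw [smul_smul, D.e_mul_of_ne h, zero_smul]

lemma ext_e_smul {w w' : W} (h : ∀ x, D.e x • w = D.e x • w') : w = w' := by
  rw [← D.sum_e_smul w, ← D.sum_e_smul w']
  exact Finset.sum_congr rfl fun x _ => h x

end SModule

section Pullback

variable (X : Type u) [AddCommGroup X] [Module Λ X]

/-- The `S`-module of a `Λ`-module: the direct sum over all `x : V` of `γ (e x) X`, encoded as the
functions `f : V → X` with `f x` in `γ (e x) X`. Its `k`-module structure is the one that is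
restricted from `S`. -/
def Pullback : Type u :=
  { f : V → X // f ∈ ({
      carrier := { f | ∀ x, D.γ (D.e x) • f x = f x }
      add_mem' := fun ha hb x => by simp only [Pi.add_apply, smul_add, ha x, hb x]
      zero_mem' := fun x => by simp
      neg_mem' := fun ha x => by rw [Pi.neg_apply, smul_neg, ha x] } : AddSubgroup (V → X)) }

namespace Pullback

instance : AddCommGroup (D.Pullback X) := by unfold Pullback; infer_instance

variable {D X}

/-- The component at `x` of an element of the pullback. -/
def val (f : D.Pullback X) : V → X := f.1

lemma e_smul_val (f : D.Pullback X) (x : V) : D.γ (D.e x) • f.val x = f.val x := f.2 x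

@[ext] lemma ext {f g : D.Pullback X} (h : ∀ x, f.val x = g.val x) : f = g :=
  Subtype.ext (funext h)

@[simp] lemma add_val (f g : D.Pullback X) (x : V) : (f + g).val x = f.val x + g.val x := rfl
@[simp] lemma zero_val (x : V) : (0 : D.Pullback X).val x = 0 := rfl

/-- Elements of the pullback are given by their components. -/
def mk (f : V → X) (hf : ∀ x, D.γ (D.e x) • f x = f x) : D.Pullback X := ⟨f, hf⟩

@[simp] lemma mk_val (f : V → X) (hf : ∀ x, D.γ (D.e x) • f x = f x) (x : V) :
    (mk (D := D) f hf).val x = f x := rfl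

instance : SMul S (D.Pullback X) where
  smul s f := mk (fun y => ∑ x, D.γ (D.e y * s * D.e x) • f.val x) (fun y => by
    rw [Finset.smul_sum]
    refine Finset.sum_congr rfl fun x _ => ?_
    rw [smul_smul, mul_assoc, γ_e_mul])

lemma smul_val (s : S) (f : D.Pullback X) (y : V) :
    (s • f).val y = ∑ x, D.γ (D.e y * s * D.e x) • f.val x := rfl

lemma e_smul_val_self (f : D.Pullback X) (x : V) : (D.e x • f).val x = f.val x := by
  rw [smul_val, Finset.sum_eq_single x]
  · rw [e_mul_self, e_mul_self, e_smul_val]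
  · intro y _ hy
    rw [e_mul_self, D.e_mul_of_ne hy.symm, map_zero, zero_smul]
  · simp

lemma e_smul_val_of_ne (f : D.Pullback X) {x y : V} (h : x ≠ y) : (D.e x • f).val y = 0 := by
  rw [smul_val]
  refine Finset.sum_eq_zero fun z _ => ?_
  rw [D.e_mul_of_ne h.symm, zero_mul, map_zero, zero_smul]

instance : Module S (D.Pullback X) where
  one_smul f := by
    ext y
    rw [smul_val, Finset.sum_eq_single y]
    · rw [mul_one, e_mul_self, e_smul_val]
    · intro x _ hx
      rw [mul_one, D.e_mul_of_ne hx.symm, map_zero, zero_smul]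
    · simp
  mul_smul s t f := by
    ext z
    simp only [smul_val, Finset.smul_sum]
    rw [Finset.sum_comm]
    refine Finset.sum_congr rfl fun x _ => ?_
    simp only [smul_smul, γ_mul_sandwich]
    rw [← Finset.sum_smul, ← map_sum]
    congr 2
    simp only [mul_assoc]
    rw [← Finset.mul_sum, ← Finset.mul_sum, ← Finset.sum_mul, sum_e, one_mul]
  smul_zero s := by ext y; simp [smul_val]
  smul_add s f g := by ext y; simp [smul_val, Finset.sum_add_distrib]
  add_smul s t f := by ext y; simp [smul_val, mul_add, add_mul, add_smul, Finset.sum_add_distrib]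
  zero_smul f := by ext y; simp [smul_val]

instance : Module k (D.Pullback X) := Module.restrictScalars k S _

instance : IsScalarTower k S (D.Pullback X) := IsScalarTower.restrictScalars k S _

lemma algebraMap_smul_val (c : k) (f : D.Pullback X) (x : V) :
    (c • f).val x = algebraMap k Λ c • f.val x := by
  rw [← one_smul S f, ← smul_assoc, smul_val, smul_val, Finset.smul_sum]
  simp only [mul_smul_comm, smul_mul_assoc, map_smul, smul_smul, ← Algebra.smul_def]

@[simp] lemma smul_val' [Module k X] [IsScalarTower k Λ X] (c : k) (f : D.Pullback X) (x : V) :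
    (c • f).val x = c • f.val x := by
  rw [algebraMap_smul_val, algebraMap_smul]

instance [Module k X] [IsScalarTower k Λ X] [FiniteDimensional k X] :
    FiniteDimensional k (D.Pullback X) :=
  Module.Finite.of_injective
    ({ toFun := val, map_add' := fun _ _ => rfl, map_smul' := fun c f => funext (smul_val' c f) } :
      D.Pullback X →ₗ[k] V → X) fun _ _ h => ext (congrFun h)

variable (D X) in
/-- The involution of the pullback that swaps the components at `x` and `E x`. -/
def swap : D.Pullback X →ₗ[k] D.Pullback X where
  toFun f := mk (fun x => f.val (D.E x)) (fun x => by rw [← D.γ_E x, e_smul_val])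
  map_add' f g := rfl
  map_smul' c f := by
    ext x
    rw [mk_val, algebraMap_smul_val, RingHom.id_apply, algebraMap_smul_val, mk_val]

@[simp] lemma swap_val (f : D.Pullback X) (x : V) : (swap D X f).val x = f.val (D.E x) := rfl

variable {Y : Type u} [AddCommGroup Y] [Module Λ Y]

/-- Functoriality of the pullback. -/
def map (g : X →ₗ[Λ] Y) : D.Pullback X →ₗ[S] D.Pullback Y where
  toFun f := mk (fun x => g (f.val x)) (fun x => by rw [← map_smul, e_smul_val])
  map_add' f f' := by ext x; simp
  map_smul' s f := by ext x; simp [smul_val]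

@[simp] lemma map_val (g : X →ₗ[Λ] Y) (f : D.Pullback X) (x : V) :
    (map g f).val x = g (f.val x) := rfl

lemma map_swap (g : X →ₗ[Λ] Y) (f : D.Pullback X) :
    map g (swap D X f) = swap D Y (map g f) := rfl

lemma map_surjective (g : X →ₗ[Λ] Y) (hg : Function.Surjective g) :
    Function.Surjective (map (D := D) g) := by
  intro f
  choose a ha using fun x => hg (f.val x)
  refine ⟨mk (fun x => D.γ (D.e x) • a x) (fun x => by rw [smul_smul, γ_e_mul_self]), ?_⟩
  ext x
  rw [map_val, mk_val, map_smul, ha, e_smul_val]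

/-- An element of a `Λ`-module, spread over all idempotents. -/
def spread (a : X) : D.Pullback X :=
  mk (fun x => D.γ (D.e x) • a) (fun x => by rw [smul_smul, γ_e_mul_self])

lemma spread_val (a : X) (x : V) : (spread (D := D) a).val x = D.γ (D.e x) • a := rfl

lemma sum_spread (a : X) : ∑ o, (spread (D := D) a).val (D.r o) = a := by
  simp only [spread_val]
  rw [← Finset.sum_smul, γ_sum, one_smul]

lemma map_spread (g : X →ₗ[Λ] Y) (a : X) : map g (spread (D := D) a) = spread (g a) := by
  ext x; simp [spread_val]

lemma map_injective {g g' : X →ₗ[Λ] Y} (h : map (D := D) g = map g') : g = g' := by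
  ext a
  have := congrArg (fun φ => ∑ o, (φ (spread (D := D) a)).val (D.r o)) h
  simpa only [map_spread, sum_spread] using this

end Pullback

end Pullback

end GluedAlgebra

/-! ### Modules with a swap -/

namespace GluedAlgebra

variable {k : Type v} {S Λ V O : Type u} [Field k] [Ring S] [Algebra k S] [Ring Λ]
    [Algebra k Λ] [Fintype V] [Fintype O] (D : GluedAlgebra k S Λ V O)

section Swap

variable {W : Type u} [AddCommGroup W] [Module k W] [Module S W]

/-- A linear involution `θ` of an `S`-module that identifies `e x W` with `e (E x) W`, and is the
identity on `e x W` if `E x = x`. An `S`-module with such an involution is the same thing as a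
`Λ`-module. -/
structure IsSwap (θ : W →ₗ[k] W) : Prop where
  sq : ∀ w, θ (θ w) = w
  map_smul : ∀ x w, θ (D.e x • w) = D.e (D.E x) • θ w
  fixed : ∀ x w, D.E x = x → θ (D.e x • w) = D.e x • w

variable {D}

open Classical in
variable (D) in
/-- Symmetrization: an element `w` of `e x W` is sent to `w` if `E x = x` and to `w + θ w`
otherwise. -/
def sym (θ : W →ₗ[k] W) (w : W) : W :=
  ∑ x, (D.e x • w + if D.E x = x then 0 else θ (D.e x • w))

lemma sym_add (θ : W →ₗ[k] W) (w w' : W) : D.sym θ (w + w') = D.sym θ w + D.sym θ w' := by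
  unfold sym
  rw [← Finset.sum_add_distrib]
  refine Finset.sum_congr rfl fun x _ => ?_
  split_ifs <;> simp only [smul_add, map_add] <;> abel

lemma sym_smul [IsScalarTower k S W] (θ : W →ₗ[k] W) (c : k) (w : W) :
    D.sym θ (c • w) = c • D.sym θ w := by
  unfold sym
  rw [Finset.smul_sum]
  refine Finset.sum_congr rfl fun x _ => ?_
  rw [smul_algebra_smul_comm, smul_add]
  split_ifs <;> simp only [_root_.map_smul, smul_zero]

lemma sym_zero (θ : W →ₗ[k] W) : D.sym θ 0 = 0 := by
  simp [sym]

lemma sym_sum {ι : Type*} (s : Finset ι) (θ : W →ₗ[k] W) (f : ι → W) :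
    D.sym θ (∑ i ∈ s, f i) = ∑ i ∈ s, D.sym θ (f i) :=
  map_sum (AddMonoidHom.mk' (D.sym θ) (sym_add θ)) f s

lemma sym_e_smul (θ : W →ₗ[k] W) (x : V) (w : W) [Decidable (D.E x = x)] :
    D.sym θ (D.e x • w) = D.e x • w + if D.E x = x then 0 else θ (D.e x • w) := by
  unfold sym
  rw [Finset.sum_eq_single x]
  · rw [e_smul_self]
    congr
  · intro y _ hy
    rw [D.e_smul_of_ne hy]
    simp
  · simp

lemma map_sym {W' : Type u} [AddCommGroup W'] [Module k W'] [Module S W'] {θ : W →ₗ[k] W}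
    {θ' : W' →ₗ[k] W'} (φ : W →ₗ[S] W') (h : ∀ w, φ (θ w) = θ' (φ w)) (w : W) :
    φ (D.sym θ w) = D.sym θ' (φ w) := by
  unfold sym
  rw [map_sum]
  refine Finset.sum_congr rfl fun x _ => ?_
  split_ifs <;> simp only [map_add, map_zero, h, _root_.map_smul]

namespace IsSwap

variable {θ : W →ₗ[k] W} (hθ : D.IsSwap θ)
include hθ

lemma map_sym_eq (w : W) : θ (D.sym θ w) = D.sym θ w := by
  classical
  rw [← D.sum_e_smul w, sym_sum, map_sum]
  refine Finset.sum_congr rfl fun x _ => ?_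
  rw [sym_e_smul]
  split_ifs with h
  · rw [add_zero, hθ.fixed x w h]
  · rw [map_add, hθ.sq, add_comm]

lemma sym_map (w : W) : D.sym θ (θ w) = D.sym θ w := by
  classical
  rw [← D.sum_e_smul w, map_sum, sym_sum, sym_sum]
  refine Finset.sum_congr rfl fun x _ => ?_
  by_cases h : D.E x = x
  · rw [hθ.fixed x w h]
  · rw [sym_e_smul, hθ.map_smul, sym_e_smul, if_neg (D.E_ne_iff.2 h), if_neg h, hθ.map_smul,
      hθ.sq, E_E, add_comm]

lemma e_smul_sym_e_smul_self (x : V) (w : W) : D.e x • D.sym θ (D.e x • w) = D.e x • w := by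
  classical
  rw [sym_e_smul, smul_add, e_smul_self]
  split_ifs with h
  · simp
  · rw [hθ.map_smul, D.e_smul_of_ne (Ne.symm h), add_zero]

lemma e_smul_sym_of_q_ne {x y : V} (h : D.q x ≠ D.q y) (w : W) :
    D.e x • D.sym θ (D.e y • w) = 0 := by
  classical
  have h₁ : x ≠ y := fun h' => h (h' ▸ rfl)
  have h₂ : x ≠ D.E y := fun h' => h (h' ▸ D.q_E y)
  rw [sym_e_smul, smul_add, D.e_smul_of_ne h₁]
  split_ifs
  · simp
  · rw [hθ.map_smul, D.e_smul_of_ne h₂, add_zero]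

lemma sym_e_smul_eq {x y : V} (h : D.q x = D.q y) {w : W} (hw : θ w = w) :
    D.sym θ (D.e x • w) = D.sym θ (D.e y • w) := by
  obtain rfl | rfl := (D.q_eq_iff _ _).1 h
  · rfl
  · nth_rw 1 [← hw]
    rw [← hθ.map_smul, hθ.sym_map]

lemma sum_sym {w : W} (hw : θ w = w) : ∑ o, D.sym θ (D.e (D.r o) • w) = w := by
  refine D.ext_e_smul fun x => ?_
  rw [Finset.smul_sum, Finset.sum_eq_single (D.q x)]
  · rw [hθ.sym_e_smul_eq (D.q_r (D.q x)) hw, hθ.e_smul_sym_e_smul_self]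
  · intro o _ ho
    exact hθ.e_smul_sym_of_q_ne (by rwa [q_r, ne_comm]) w
  · simp

end IsSwap

/-- The space of elements fixed by a swap. It is a `Λ`-module. -/
def Fixed {θ : W →ₗ[k] W} (_ : D.IsSwap θ) : Type u := LinearMap.eqLocus θ LinearMap.id

namespace Fixed

variable {θ : W →ₗ[k] W} (hθ : D.IsSwap θ)

instance : AddCommGroup (Fixed hθ) := by unfold Fixed; infer_instance
instance : Module k (Fixed hθ) := by unfold Fixed; infer_instance

variable {hθ}

/-- The underlying element of `W`. -/
def val (w : Fixed hθ) : W := w.1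

@[ext] lemma ext {w w' : Fixed hθ} (h : w.val = w'.val) : w = w' := Subtype.ext h

lemma map_val (w : Fixed hθ) : θ w.val = w.val := w.2

/-- Constructor for fixed elements. -/
def mk (w : W) (hw : θ w = w) : Fixed hθ := ⟨w, hw⟩

@[simp] lemma mk_val (w : W) (hw : θ w = w) : (mk (hθ := hθ) w hw).val = w := rfl
@[simp] lemma add_val (w w' : Fixed hθ) : (w + w').val = w.val + w'.val := rfl
@[simp] lemma zero_val : (0 : Fixed hθ).val = 0 := rfl
@[simp] lemma smul_val' (c : k) (w : Fixed hθ) : (c • w).val = c • w.val := rfl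

lemma sum_val {ι : Type*} (s : Finset ι) (f : ι → Fixed hθ) :
    (∑ i ∈ s, f i).val = ∑ i ∈ s, (f i).val :=
  map_sum (AddMonoidHom.mk' (val (hθ := hθ)) fun _ _ => rfl) f s

variable (hθ) [IsScalarTower k S W]

/-- An element of `S` acts on the fixed elements by multiplication followed by symmetrization. -/
def action : S →ₗ[k] Module.End k (Fixed hθ) where
  toFun s :=
    { toFun := fun w => mk (D.sym θ (s • w.val)) (hθ.map_sym_eq _)
      map_add' := fun w w' => by ext; simp [sym_add]
      map_smul' := fun c w => by
        ext
        simp only [mk_val, smul_val', smul_algebra_smul_comm, sym_smul, RingHom.id_apply] }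
  map_add' s t := by ext w; simp [add_smul, sym_add]
  map_smul' c s := by ext w; simp [sym_smul]

lemma action_val (s : S) (w : Fixed hθ) : (action hθ s w).val = D.sym θ (s • w.val) := rfl

lemma exists_algHom :
    ∃ Φ : Λ →ₐ[k] Module.End k (Fixed hθ), ∀ s, Φ (D.γ s) = action hθ s := by
  refine D.exists_lift (action hθ) ?_ ?_ ?_ ?_
  · intro s t x
    ext w
    rw [Module.End.mul_apply, action_val, action_val, action_val, mul_smul, mul_smul,
      hθ.e_smul_sym_e_smul_self, mul_smul, mul_smul]
  · intro x
    ext w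
    exact hθ.sym_e_smul_eq (D.q_E x) w.map_val
  · intro x y h
    ext w
    rw [Module.End.mul_apply, action_val, action_val, hθ.e_smul_sym_of_q_ne h, sym_zero]
    rfl
  · ext w
    rw [LinearMap.sum_apply, sum_val]
    exact hθ.sum_sym w.map_val

instance : Module Λ (Fixed hθ) :=
  Module.compHom _ (exists_algHom hθ).choose.toRingHom

lemma γ_smul_val (s : S) (w : Fixed hθ) : (D.γ s • w).val = D.sym θ (s • w.val) := by
  change ((exists_algHom hθ).choose (D.γ s) w).val = _
  rw [(exists_algHom hθ).choose_spec, action_val]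

instance : IsScalarTower k Λ (Fixed hθ) where
  smul_assoc c a w := by
    change (exists_algHom hθ).choose (c • a) w = c • (exists_algHom hθ).choose a w
    rw [_root_.map_smul, LinearMap.smul_apply]

end Fixed

end Swap

/-- A `k`-linear map between `Λ`-modules is `Λ`-linear if it commutes with the action of the
elements `γ s`. -/
def linearMapOfγ {X Y : Type*} [AddCommGroup X] [Module k X] [Module Λ X] [IsScalarTower k Λ X]
    [AddCommGroup Y] [Module k Y] [Module Λ Y] [IsScalarTower k Λ Y] (f : X →ₗ[k] Y)
    (h : ∀ s a, f (D.γ s • a) = D.γ s • f a) : X →ₗ[Λ] Y where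
  toFun := f
  map_add' := map_add f
  map_smul' l a := by
    have hl : l ∈ Algebra.adjoin k (Set.range D.γ) := by rw [D.γ_adjoin]; trivial
    induction hl using Algebra.adjoin_induction generalizing a with
    | mem l hl => obtain ⟨s, rfl⟩ := hl; exact h s a
    | algebraMap c =>
      simp only [algebraMap_smul, _root_.map_smul, RingHom.id_apply]
    | add l l' _ _ hl hl' =>
      simp only [add_smul, map_add, RingHom.id_apply] at hl hl' ⊢
      rw [hl, hl']
    | mul l l' _ _ hl hl' =>
      simp only [mul_smul, RingHom.id_apply] at hl hl' ⊢
      rw [hl, hl']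

section

variable {X : Type u} [AddCommGroup X] [Module Λ X]

lemma Pullback.isSwap : D.IsSwap (Pullback.swap D X) where
  sq f := by ext x; simp [E_E]
  map_smul x f := by
    ext y
    rw [swap_val]
    by_cases h : D.E x = y
    · subst h
      rw [E_E, e_smul_val_self, e_smul_val_self, swap_val, E_E]
    · rw [e_smul_val_of_ne _ h, e_smul_val_of_ne]
      rintro rfl
      exact h (D.E_E y)
  fixed x f hx := by
    ext y
    rw [swap_val]
    by_cases h : x = y
    · subst h
      rw [hx]
    · rw [e_smul_val_of_ne _ h, e_smul_val_of_ne]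
      rintro rfl
      exact h (hx.symm.trans (D.E_E y))

/-- The pullback of a `Λ`-module, together with the swap, determines the `Λ`-module. -/
lemma Pullback.sym_e_smul (f : D.Pullback X) (x : V) :
    D.sym (swap D X) (D.e x • f) = spread (f.val x) := by
  classical
  ext y
  rw [GluedAlgebra.sym_e_smul, spread_val]
  by_cases hxy : D.q x = D.q y
  · rw [← D.γ_e_eq hxy, e_smul_val]
    obtain rfl | hne := eq_or_ne x y
    · rw [add_val, e_smul_val_self]
      split_ifs with h
      · simp
      · rw [swap_val, e_smul_val_of_ne _ (Ne.symm h), add_zero]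
    · have hxy' : x = D.E y := ((D.q_eq_iff _ _).1 hxy).resolve_left hne
      have hy : D.E y ≠ y := hxy' ▸ hne
      subst hxy'
      rw [add_val, e_smul_val_of_ne _ hne, if_neg (D.E_ne_iff.2 hy), swap_val, e_smul_val_self,
        zero_add]
  · have h₁ : x ≠ y := fun h => hxy (h ▸ rfl)
    have h₂ : x ≠ D.E y := fun h => hxy (h ▸ D.q_E y)
    rw [add_val, e_smul_val_of_ne _ h₁, ← e_smul_val f x, smul_smul,
      D.γ_orthogonal _ _ (Ne.symm hxy), zero_smul]
    split_ifs
    · simp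
    · rw [swap_val, e_smul_val_of_ne _ h₂, add_zero]

end

end GluedAlgebra

/-! ### Modules over the gluing as modules with a swap -/

namespace GluedAlgebra

variable {k : Type v} {S Λ V O : Type u} [Field k] [Ring S] [Algebra k S] [Ring Λ]
    [Algebra k Λ] [Fintype V] [Fintype O] {D : GluedAlgebra k S Λ V O}

section

variable {X : Type u} [AddCommGroup X] [Module Λ X]

namespace Pullback

lemma spread_injective : Function.Injective (spread (D := D) (X := X)) := fun a b h => by
  rw [← sum_spread (D := D) a, ← sum_spread (D := D) b, h]

lemma spread_sum {ι : Type*} (s : Finset ι) (f : ι → X) :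
    spread (D := D) (∑ i ∈ s, f i) = ∑ i ∈ s, spread (f i) :=
  map_sum (AddMonoidHom.mk' (spread (D := D) (X := X)) fun a b => by ext; simp [spread_val]) f s

lemma spread_of_swap {f : D.Pullback X} (hf : swap D X f = f) :
    spread (∑ o, f.val (D.r o)) = f := by
  ext x
  rw [spread_val, Finset.smul_sum, Finset.sum_eq_single (D.q x)]
  · rw [D.γ_e_eq (D.q_r (D.q x)).symm, e_smul_val]
    obtain h | h := (D.q_eq_iff _ _).1 (D.q_r (D.q x))
    · rw [h]
    · rw [h, ← swap_val, hf]
  · intro o _ ho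
    rw [← e_smul_val, smul_smul, D.γ_orthogonal _ _ (by rwa [q_r, ne_comm]), zero_smul]
  · simp

lemma sym_smul_spread (s : S) (a : X) :
    D.sym (swap D X) (s • spread a) = spread (D.γ s • a) := by
  rw [← D.sum_e_smul (s • spread a), sym_sum]
  simp only [sym_e_smul]
  rw [← spread_sum]
  congr 1
  simp only [smul_val, spread_val, smul_smul, γ_mul_e]
  simp only [← Finset.sum_smul, ← map_sum, ← Finset.mul_sum, ← Finset.sum_mul, sum_e, mul_one,
    one_mul]

end Pullback

end

section

variable {W : Type u} [AddCommGroup W] [Module k W] [Module S W] [IsScalarTower k S W]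
  {θ : W →ₗ[k] W} (hθ : D.IsSwap θ)

namespace Fixed

/-- An `S`-module with a swap `θ` is the pullback of the `Λ`-module of fixed elements. -/
def toPullback : W →ₗ[S] D.Pullback (Fixed hθ) where
  toFun w := Pullback.mk (fun x => mk (D.sym θ (D.e x • w)) (hθ.map_sym_eq _)) (fun x => by
    ext
    rw [γ_smul_val, mk_val, hθ.e_smul_sym_e_smul_self])
  map_add' w w' := by ext x; simp [sym_add]
  map_smul' s w := by
    ext y
    simp only [Pullback.smul_val, Pullback.mk_val, sum_val, γ_smul_val, mk_val, mul_smul,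
      hθ.e_smul_sym_e_smul_self, RingHom.id_apply]
    rw [← sym_sum, ← Finset.smul_sum, ← Finset.smul_sum, sum_e_smul]

lemma toPullback_val_val (w : W) (x : V) :
    ((toPullback hθ w).val x).val = D.sym θ (D.e x • w) := rfl

lemma toPullback_map (w : W) :
    toPullback hθ (θ w) = Pullback.swap D _ (toPullback hθ w) := by
  ext x
  rw [toPullback_val_val, Pullback.swap_val, toPullback_val_val, ← hθ.sym_map (D.e (D.E x) • w),
    hθ.map_smul, E_E]

lemma toPullback_bijective : Function.Bijective (toPullback hθ) := by
  constructor
  · intro w w' h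
    refine D.ext_e_smul fun x => ?_
    rw [← hθ.e_smul_sym_e_smul_self, ← hθ.e_smul_sym_e_smul_self x w', ← toPullback_val_val hθ, h,
      toPullback_val_val]
  · intro f
    refine ⟨∑ y, D.e y • (f.val y).val, ?_⟩
    ext x
    rw [toPullback_val_val, Finset.smul_sum, Finset.sum_eq_single x]
    · rw [e_smul_self, ← γ_smul_val, Pullback.e_smul_val]
    · intro y _ hy
      rw [D.e_smul_of_ne hy.symm]
    · simp

/-- The isomorphism between a module with a swap and the pullback of its fixed elements. -/
def equivPullback : W ≃ₗ[S] D.Pullback (Fixed hθ) :=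
  LinearEquiv.ofBijective _ (toPullback_bijective hθ)

variable {X : Type u} [AddCommGroup X] [Module Λ X]

section lift

variable {hθ} (φ : W →ₗ[S] D.Pullback X) (h : ∀ w, φ (θ w) = Pullback.swap D X (φ w))
include h

omit [IsScalarTower k S W] in
lemma spread_sum_of_map (w : Fixed hθ) :
    Pullback.spread (∑ o, (φ w.val).val (D.r o)) = φ w.val :=
  Pullback.spread_of_swap (by rw [← h, map_val])

variable [Module k X] [IsScalarTower k Λ X]

/-- A map of modules with swaps from `W` to the pullback of `X` induces a map from the module of
fixed elements of `W` to `X`. -/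
def lift : Fixed hθ →ₗ[Λ] X :=
  D.linearMapOfγ
    { toFun := fun w => ∑ o, (φ w.val).val (D.r o)
      map_add' := fun w w' => by simp [Finset.sum_add_distrib]
      map_smul' := fun c w => by
        have : φ (c • w.val) = c • φ w.val := by
          rw [algebra_compatible_smul S c w.val, map_smul, algebraMap_smul]
        simp [this, Finset.smul_sum] }
    (fun s w => by
      apply Pullback.spread_injective (D := D)
      refine (spread_sum_of_map φ h _).trans ?_
      rw [γ_smul_val, map_sym φ h, map_smul, ← Pullback.sym_smul_spread]
      exact congrArg (fun f => D.sym _ (s • f)) (spread_sum_of_map φ h w).symm)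

lemma map_lift (w : W) : Pullback.map (lift φ h) (toPullback hθ w) = φ w := by
  ext x
  have : φ (D.sym θ (D.e x • w)) = Pullback.spread ((φ w).val x) := by
    rw [map_sym φ h, map_smul, Pullback.sym_e_smul]
  change ∑ o, (φ (D.sym θ (D.e x • w))).val (D.r o) = _
  rw [this, Pullback.sum_spread]

end lift

/-- A map of `S`-modules between pullbacks that commutes with the swaps comes from a map of
`Λ`-modules. -/
lemma _root_.GluedAlgebra.Pullback.exists_map_eq [Module k X] [IsScalarTower k Λ X]
    {Y : Type u} [AddCommGroup Y] [Module k Y] [Module Λ Y] [IsScalarTower k Λ Y] (φ : D.Pullback X →ₗ[S] D.Pullback Y)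
    (h : ∀ f, φ (Pullback.swap D X f) = Pullback.swap D Y (φ f)) :
    ∃ g : X →ₗ[Λ] Y, Pullback.map g = φ := by
  let α : X →ₗ[Λ] Fixed (Pullback.isSwap D (X := X)) := D.linearMapOfγ
    { toFun := fun a => mk (Pullback.spread a) (by
        ext x; rw [Pullback.swap_val, Pullback.spread_val, Pullback.spread_val, γ_E])
      map_add' := fun a b => by ext; simp [Pullback.spread_val]
      map_smul' := fun c a => by
        ext
        simp [Pullback.spread_val, smul_algebra_smul_comm] }
    (fun s a => by
      ext1
      rw [γ_smul_val]
      exact (Pullback.sym_smul_spread s a).symm)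
  have hα (a : X) : (α a).val = Pullback.spread a := rfl
  refine ⟨(lift φ h).comp α, ?_⟩
  ext f x
  rw [← map_lift φ h f (hθ := Pullback.isSwap D), Pullback.map_val, Pullback.map_val,
    LinearMap.comp_apply]
  congr 1
  ext1
  rw [toPullback_val_val, hα, Pullback.sym_e_smul]

section generation

variable {N : Type*} [AddCommGroup N] [Module S N] (i : N →ₗ[S] W)
  (hi : ∀ L : Submodule S W, (∀ n, i n ∈ L) → (∀ w ∈ L, θ w ∈ L) → L = ⊤)
include hi

/-- If the `S`-module `W` is generated, as a module with swap, by a finite-dimensional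
submodule, then the `Λ`-module of fixed elements is finitely generated. -/
lemma finite_of_generated [Module k N] [IsScalarTower k S N] [FiniteDimensional k N] :
    Module.Finite Λ (Fixed hθ) := by
  let g (x : V) (n : N) : Fixed hθ := mk (D.sym θ (D.e x • i n)) (hθ.map_sym_eq _)
  let b := Module.finBasis k N
  let L : Submodule Λ (Fixed hθ) := Submodule.span Λ (Set.range fun p : V × Fin _ => g p.1 (b p.2))
  have hg (x : V) (n : N) : g x n ∈ L := by
    have : g x n = ∑ j, b.repr n j • g x (b j) := by
      ext
      rw [sum_val]
      simp only [smul_val', g, mk_val]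
      have hik (c : k) (n : N) : i (c • n) = c • i n := by
        rw [algebra_compatible_smul S c n, map_smul, algebraMap_smul]
      nth_rw 1 [← b.sum_repr n]
      rw [map_sum, Finset.smul_sum, sym_sum]
      refine Finset.sum_congr rfl fun j _ => ?_
      rw [hik, smul_algebra_smul_comm, sym_smul]
    rw [this]
    refine L.sum_mem fun j _ => ?_
    rw [algebra_compatible_smul Λ]
    exact L.smul_mem _ (Submodule.subset_span ⟨(x, j), rfl⟩)
  let L' : Submodule S W :=
    { carrier := { w | ∀ x, (toPullback hθ w).val x ∈ L }
      add_mem' := fun ha hb x => by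
        rw [map_add, Pullback.add_val]; exact L.add_mem (ha x) (hb x)
      zero_mem' := fun x => by simp
      smul_mem' := fun s w hw y => by
        rw [map_smul, Pullback.smul_val]
        exact L.sum_mem fun x _ => L.smul_mem _ (hw x) }
  have hL' : L' = ⊤ := by
    refine hi L' (fun n x => hg x n) fun w hw x => ?_
    rw [toPullback_map]
    exact hw (D.E x)
  refine ⟨?_⟩
  have hL : L = ⊤ := by
    rw [eq_top_iff]
    intro w _
    have : w = ∑ o, (toPullback hθ w.val).val (D.r o) := by
      ext
      rw [sum_val]
      exact (hθ.sum_sym w.map_val).symm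
    rw [this]
    have hw : w.val ∈ L' := by rw [hL']; trivial
    exact L.sum_mem fun o _ => hw (D.r o)
  rw [← hL]
  exact Submodule.fg_span (Set.finite_range _)

/-- Two maps out of the module of fixed elements agree if they agree on generators. -/
lemma hom_ext_of_generated {g g' : Fixed hθ →ₗ[Λ] X}
    (h : ∀ n, Pullback.map g (toPullback hθ (i n)) = Pullback.map g' (toPullback hθ (i n))) :
    g = g' := by
  apply Pullback.map_injective (D := D)
  have := hi (LinearMap.eqLocus ((Pullback.map g).comp (toPullback hθ))
    ((Pullback.map g').comp (toPullback hθ))) h (fun w hw => by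
      rw [LinearMap.mem_eqLocus, LinearMap.comp_apply, LinearMap.comp_apply] at hw ⊢
      rw [toPullback_map, Pullback.map_swap, Pullback.map_swap, hw])
  ext1 f
  obtain ⟨w, rfl⟩ := (toPullback_bijective hθ).2 f
  have hw : w ∈ (⊤ : Submodule S W) := trivial
  rw [← this] at hw
  exact hw

end generation

end Fixed

end

end GluedAlgebra

/-! ### The induced module and its basis of words -/

/-- The elements of the basis of a direct sum that is assembled from bases of the summands. -/
lemma DFinsupp.basis_apply {ι R : Type*} [Semiring R] {M η : ι → Type*} [∀ i, AddCommMonoid (M i)]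
    [∀ i, Module R (M i)] [DecidableEq ι] (b : ∀ i, Module.Basis (η i) R (M i)) (i : ι) (j : η i) :
    DFinsupp.basis b ⟨i, j⟩ = DFinsupp.single i (b i j) := by
  classical
  rw [Module.Basis.apply_eq_iff]
  change (sigmaFinsuppLequivDFinsupp R).symm (DFinsupp.mapRange (fun i => (b i).repr)
    (fun i => map_zero _) (DFinsupp.single i (b i j))) = _
  rw [DFinsupp.mapRange_single, LinearEquiv.symm_apply_eq]
  simp

namespace GluedAlgebra

variable {k : Type v} {S Λ V O : Type u} [Field k] [Ring S] [Algebra k S] [Ring Λ]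
    [Algebra k Λ] [Fintype V] [Fintype O] (D : GluedAlgebra k S Λ V O)

/-- A basis of an `S`-module is homogeneous if each basis element lies in some `e x N`. -/
def IsHomogeneous {N : Type*} [AddCommGroup N] [Module S N] {ι : Type*} (b : ι → N)
    (d : ι → V) : Prop :=
  ∀ i, D.e (d i) • b i = b i

/-- A linearly independent set of homogeneous elements extends to a homogeneous basis, as the
homogeneous elements span the module. -/
lemma exists_homogeneous_basis_extending {N : Type u} [AddCommGroup N] [Module k N] [Module S N]
    (s : Set N) (hs : LinearIndepOn k id s) (hs' : ∀ n ∈ s, ∃ x, D.e x • n = n) :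
    ∃ (t : Set N) (b : Module.Basis t k N) (d : t → V), s ⊆ t ∧ (∀ i, b i = i) ∧
      D.IsHomogeneous b d := by
  let u : Set N := { n | ∃ x, D.e x • n = n }
  have hsu : s ⊆ u := hs'
  have hu : ⊤ ≤ Submodule.span k u := by
    intro n _
    rw [← D.sum_e_smul n]
    exact Submodule.sum_mem _ fun x _ => Submodule.subset_span ⟨x, D.e_smul_self x n⟩
  have hd (i : hs.extend hsu) : ∃ x, D.e x • (i : N) = i := hs.extend_subset hsu i.2
  choose d hd using hd
  refine ⟨_, Module.Basis.extendLe hs hsu hu, d, hs.subset_extend hsu, fun i => ?_, fun i => ?_⟩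
  · exact Module.Basis.extendLe_apply_self hs hsu hu i
  · rw [Module.Basis.extendLe_apply_self]
    exact hd i

lemma exists_homogeneous_basis (N : Type u) [AddCommGroup N] [Module k N] [Module S N] :
    ∃ (ι : Type u) (b : Module.Basis ι k N) (d : ι → V), D.IsHomogeneous b d := by
  obtain ⟨t, b, d, -, -, h⟩ := D.exists_homogeneous_basis_extending (k := k) (N := N) ∅
    (linearIndepOn_empty _ _) (by simp)
  exact ⟨t, b, d, h⟩

/-- The projective `S`-module `S e_z`. -/
abbrev proj (z : V) : Submodule S S := Submodule.span S {D.e z}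

/-- The generator `e_z` of `S e_z`. -/
def projGen (z : V) : D.proj z := ⟨D.e z, Submodule.mem_span_singleton_self _⟩

variable {D} in
lemma proj_mul_e {z : V} (s : D.proj z) : (s : S) * D.e z = s := by
  obtain ⟨t, ht⟩ := Submodule.mem_span_singleton.1 s.2
  rw [← ht, smul_eq_mul, mul_assoc, e_mul_self]

lemma exists_basis_proj (z : V) :
    ∃ (J : Type u) (tgt : J → V) (b : Module.Basis (Option J) k (D.proj z)),
      b none = D.projGen z ∧ ∀ j, D.e (tgt j) • b (some j) = b (some j) := by
  classical
  have hne : D.projGen z ≠ 0 := fun h => D.e_ne_zero z (congrArg Subtype.val h)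
  obtain ⟨t, b, d, hst, hb, hd⟩ := D.exists_homogeneous_basis_extending (k := k) (N := D.proj z)
    {D.projGen z} (LinearIndepOn.singleton hne) (by
      rintro _ rfl
      exact ⟨z, Subtype.ext (D.e_mul_self z)⟩)
  let p : t := ⟨D.projGen z, hst rfl⟩
  refine ⟨{ i : t // i ≠ p }, fun i => d i.1, b.reindex (Equiv.optionSubtypeNe p).symm, ?_, ?_⟩
  · simp [hb, p]
  · intro j
    simpa using hd j.1

/-- Together with `e_z`, this indexes a homogeneous basis of `S e_z`. -/
def J (z : V) : Type u := (D.exists_basis_proj z).choose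

variable {D} in
/-- The index in `V` of a basis element of `S e_z`. -/
def tgt {z : V} : D.J z → V := (D.exists_basis_proj z).choose_spec.choose

/-- A homogeneous basis of `S e_z` that contains `e_z`. -/
def projBasis (z : V) : Module.Basis (Option (D.J z)) k (D.proj z) :=
  (D.exists_basis_proj z).choose_spec.choose_spec.choose

lemma projBasis_none (z : V) : D.projBasis z none = D.projGen z :=
  (D.exists_basis_proj z).choose_spec.choose_spec.choose_spec.1

lemma e_smul_projBasis_some {z : V} (j : D.J z) :
    D.e (tgt j) • D.projBasis z (some j) = D.projBasis z (some j) :=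
  (D.exists_basis_proj z).choose_spec.choose_spec.choose_spec.2 j

lemma smul_projGen {z : V} (s : D.proj z) : (s : S) • D.projGen z = s :=
  Subtype.ext (proj_mul_e s)

/-- Alternating words: basis elements of the `S`-module part of the module induced from an
`S`-module with homogeneous basis `(ι, d)`. A word is a generator `i : ι`, or it continues a word
`a` of degree `x ≠ E x` by moving from `x` to `E x` and multiplying with a basis element of
`S e_{E x}` different from `e_{E x}`. -/
inductive Letter {ι : Type u} (d : ι → V) : V → Type u
  | gen (i : ι) : Letter d (d i)
  | cons {x : V} (a : Letter d x) (h : D.E x ≠ x) (j : D.J (D.E x)) : Letter d (tgt j)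

variable {ι : Type u} (d : ι → V)

/-- All words, of all degrees. -/
abbrev Letters : Type u := Σ x, D.Letter d x

/-- The words whose degree is not a fixed point of `E`. -/
abbrev FreeLetters : Type u := { a : D.Letters d // D.E a.1 ≠ a.1 }

variable (N : Type u) [AddCommGroup N]

/-- The pullback of the `Λ`-module induced from an `S`-module `N` with a homogeneous basis of
degrees `d`: the sum of `N` and of a copy of `S e_{E x}` for each word of degree `x ≠ E x`. The
generator of this copy is the swap of the word. -/
abbrev Induced : Type u := N × Π₀ a : D.FreeLetters d, D.proj (D.E a.1.1)

/-- The index set of a basis of the induced module: a word `a`, or a word `a` that has been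
moved to the other side of the gluing. -/
abbrev InducedIndex : Type u := D.Letters d ⊕ D.FreeLetters d

/-- The degree of a basis element of the induced module. -/
def deg : D.InducedIndex d → V := Sum.elim (fun a => a.1) (fun a => D.E a.1.1)

/-- A word is a generator or a continuation of a shorter word. -/
def lettersEquiv : D.Letters d ≃ ι ⊕ Σ a : D.FreeLetters d, D.J (D.E a.1.1) where
  toFun
    | ⟨_, .gen i⟩ => Sum.inl i
    | ⟨_, .cons a h j⟩ => Sum.inr ⟨⟨⟨_, a⟩, h⟩, j⟩
  invFun
    | Sum.inl i => ⟨_, .gen i⟩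
    | Sum.inr ⟨⟨⟨_, a⟩, h⟩, j⟩ => ⟨_, .cons a h j⟩
  left_inv := by rintro ⟨_, _ | _⟩ <;> rfl
  right_inv := by rintro (_ | ⟨⟨⟨_, _⟩, _⟩, _⟩) <;> rfl

/-- The identification of the two natural index sets of the basis of the induced module. -/
def inducedIndexEquiv :
    (ι ⊕ Σ a : D.FreeLetters d, Option (D.J (D.E a.1.1))) ≃ D.InducedIndex d where
  toFun
    | Sum.inl i => Sum.inl ((D.lettersEquiv d).symm (Sum.inl i))
    | Sum.inr ⟨a, none⟩ => Sum.inr a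
    | Sum.inr ⟨a, some j⟩ => Sum.inl ((D.lettersEquiv d).symm (Sum.inr ⟨a, j⟩))
  invFun
    | Sum.inl a => (D.lettersEquiv d a).elim Sum.inl (fun p => Sum.inr ⟨p.1, some p.2⟩)
    | Sum.inr a => Sum.inr ⟨a, none⟩
  left_inv := by
    rintro (i | ⟨a, _ | j⟩)
    · simp
    · rfl
    · simp
  right_inv := by
    rintro (⟨_, _ | _⟩ | _) <;> rfl

open Classical in
/-- The involution of the basis of the induced module. -/
def inducedPerm : Equiv.Perm (D.InducedIndex d) :=
  Function.Involutive.toPerm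
    (fun
      | Sum.inl a => if h : D.E a.1 ≠ a.1 then Sum.inr ⟨a, h⟩ else Sum.inl a
      | Sum.inr a => Sum.inl a.1)
    (by
      rintro (a | a)
      · dsimp only
        split_ifs with h
        · rfl
        · simp only [dif_neg h]
      · simp only [dif_pos a.2])

lemma inducedPerm_inl (a : D.FreeLetters d) : D.inducedPerm d (Sum.inl a.1) = Sum.inr a :=
  dif_pos a.2

lemma inducedPerm_inl_of_fixed (a : D.Letters d) (h : D.E a.1 = a.1) :
    D.inducedPerm d (Sum.inl a) = Sum.inl a :=
  dif_neg (by simpa using h)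

lemma inducedPerm_inr (a : D.FreeLetters d) : D.inducedPerm d (Sum.inr a) = Sum.inl a.1 := rfl

lemma inducedPerm_inducedPerm (β : D.InducedIndex d) :
    D.inducedPerm d (D.inducedPerm d β) = β :=
  (Function.Involutive.toPerm_involutive _) β

lemma deg_inducedPerm (β : D.InducedIndex d) :
    D.deg d (D.inducedPerm d β) = D.E (D.deg d β) := by
  obtain a | a := β
  · by_cases h : D.E a.1 = a.1
    · rw [inducedPerm_inl_of_fixed _ _ _ h]; exact h.symm
    · rw [D.inducedPerm_inl d ⟨a, h⟩]; rfl
  · exact (D.E_E _).symm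

lemma inducedPerm_of_fixed (β : D.InducedIndex d) (h : D.E (D.deg d β) = D.deg d β) :
    D.inducedPerm d β = β := by
  obtain a | a := β
  · exact D.inducedPerm_inl_of_fixed d a h
  · exact absurd (h : D.E (D.E a.1.1) = D.E a.1.1) (D.E_ne_iff.2 a.2)

variable {N d} [Module k N] (b : Module.Basis ι k N)

open Classical in
/-- The basis of the induced module. -/
def inducedBasis : Module.Basis (D.InducedIndex d) k (D.Induced d N) :=
  (b.prod (DFinsupp.basis fun a : D.FreeLetters d => D.projBasis (D.E a.1.1))).reindex
    (D.inducedIndexEquiv d)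

open Classical in
lemma inducedBasis_inr (a : D.FreeLetters d) :
    D.inducedBasis b (Sum.inr a) = (0, DFinsupp.single a (D.projGen _)) := by
  have : (D.inducedIndexEquiv d).symm (Sum.inr a) = Sum.inr ⟨a, none⟩ := rfl
  rw [inducedBasis, Module.Basis.reindex_apply, this]
  simp [projBasis_none, DFinsupp.basis_apply]

lemma inducedBasis_gen (i : ι) :
    D.inducedBasis (d := d) b (Sum.inl ⟨_, .gen i⟩) = (b i, 0) := by
  have : (D.inducedIndexEquiv d).symm (Sum.inl ⟨_, .gen i⟩) = Sum.inl i := rfl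
  rw [inducedBasis, Module.Basis.reindex_apply, this]
  simp

open Classical in
lemma inducedBasis_cons {x : V} (a : D.Letter d x) (h : D.E x ≠ x) (j : D.J (D.E x)) :
    D.inducedBasis b (Sum.inl ⟨_, .cons a h j⟩) =
      (0, DFinsupp.single (⟨⟨x, a⟩, h⟩ : D.FreeLetters d) (D.projBasis (D.E x) (some j))) := by
  have : (D.inducedIndexEquiv d).symm (Sum.inl ⟨_, .cons a h j⟩) =
    Sum.inr ⟨⟨⟨x, a⟩, h⟩, some j⟩ := rfl
  rw [inducedBasis, Module.Basis.reindex_apply, this]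
  simp [DFinsupp.basis_apply]

lemma inducedBasis_cons' [Module S N] {x : V} (a : D.Letter d x) (h : D.E x ≠ x) (j : D.J (D.E x)) :
    D.inducedBasis b (Sum.inl ⟨_, .cons a h j⟩) =
      (D.projBasis (D.E x) (some j) : S) • D.inducedBasis b (Sum.inr ⟨⟨x, a⟩, h⟩) := by
  classical
  rw [inducedBasis_inr, inducedBasis_cons, Prod.smul_mk, smul_zero, ← DFinsupp.single_smul,
    smul_projGen]

/-- The swap of the induced module: it exchanges a word `a` of degree `x ≠ E x` with the generator
of the copy of `S e_{E x}` that belongs to `a`, and fixes the words of degree `x = E x`. -/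
def inducedSwap : D.Induced d N →ₗ[k] D.Induced d N :=
  (D.inducedBasis b).constr k fun β => D.inducedBasis b (D.inducedPerm d β)

lemma inducedSwap_basis (β : D.InducedIndex d) :
    D.inducedSwap b (D.inducedBasis b β) = D.inducedBasis b (D.inducedPerm d β) := by
  simp [inducedSwap]

variable {b} [Module S N] (hb : D.IsHomogeneous b d)
include hb

lemma isHomogeneous_inducedBasis : D.IsHomogeneous (D.inducedBasis (d := d) b) (D.deg d) := by
  classical
  rintro (⟨_, i | ⟨a, h, j⟩⟩ | a)
  · rw [inducedBasis_gen, Prod.smul_mk, smul_zero]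
    exact Prod.ext (hb i) rfl
  · rw [inducedBasis_cons, Prod.smul_mk, smul_zero, ← DFinsupp.single_smul]
    exact congrArg (fun s => (0, DFinsupp.single _ s)) (D.e_smul_projBasis_some j)
  · rw [inducedBasis_inr, Prod.smul_mk, smul_zero, ← DFinsupp.single_smul]
    exact congrArg (fun s => (0, DFinsupp.single _ s)) (Subtype.ext (D.e_mul_self _))

/-- Multiplication with a fixed element as a `k`-linear map. -/
def smulHom (k : Type v) [Field k] [Algebra k S] {W : Type*} [AddCommGroup W] [Module k W]
    [Module S W] [IsScalarTower k S W] (s : S) : W →ₗ[k] W where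
  toFun w := s • w
  map_add' := smul_add s
  map_smul' c w := smul_algebra_smul_comm c s w

lemma isSwap_inducedSwap [IsScalarTower k S N] : D.IsSwap (D.inducedSwap (d := d) b) := by
  classical
  have he (x : V) (β : D.InducedIndex d) : D.e x • D.inducedBasis b β =
      if x = D.deg d β then D.inducedBasis b β else 0 := by
    split_ifs with h
    · rw [h]; exact D.isHomogeneous_inducedBasis hb β
    · rw [← D.isHomogeneous_inducedBasis hb β, D.e_smul_of_ne h]
  constructor
  · intro w
    have : (D.inducedSwap b).comp (D.inducedSwap b) = LinearMap.id :=
      (D.inducedBasis (d := d) b).ext fun β => by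
        rw [LinearMap.comp_apply, inducedSwap_basis, inducedSwap_basis, inducedPerm_inducedPerm]
        rfl
    exact LinearMap.congr_fun this w
  · intro x w
    have : (D.inducedSwap b).comp (smulHom k (D.e x)) =
        (smulHom k (D.e (D.E x))).comp (D.inducedSwap b) :=
      (D.inducedBasis (d := d) b).ext fun β => by
        change D.inducedSwap b (D.e x • _) = D.e (D.E x) • D.inducedSwap b _
        rw [he, inducedSwap_basis, he, deg_inducedPerm]
        simp only [D.involutive.injective.eq_iff]
        split_ifs
        · rw [inducedSwap_basis]
        · rw [map_zero]
    exact LinearMap.congr_fun this w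
  · intro x w hx
    have : (D.inducedSwap b).comp (smulHom k (D.e x)) = smulHom k (D.e x) :=
      (D.inducedBasis (d := d) b).ext fun β => by
        change D.inducedSwap b (D.e x • _) = D.e x • _
        rw [he]
        split_ifs with h
        · rw [inducedSwap_basis, inducedPerm_of_fixed]
          rw [← h, hx]
        · rw [map_zero]
    exact LinearMap.congr_fun this w

omit hb in
/-- As a module with swap, the induced module is generated by `N`. -/
lemma induced_generated [IsScalarTower k S N] (L : Submodule S (D.Induced d N))
    (h₁ : ∀ n, LinearMap.inl S N _ n ∈ L) (h₂ : ∀ w ∈ L, D.inducedSwap b w ∈ L) : L = ⊤ := by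
  have hinr (a : D.FreeLetters d) (ha : D.inducedBasis b (Sum.inl a.1) ∈ L) :
      D.inducedBasis b (Sum.inr a) ∈ L := by
    have := h₂ _ ha
    rwa [inducedSwap_basis, inducedPerm_inl] at this
  have hinl {x : V} (a : D.Letter d x) : D.inducedBasis b (Sum.inl ⟨x, a⟩) ∈ L := by
    induction a with
    | gen i => rw [inducedBasis_gen]; exact h₁ _
    | cons a h j ih =>
      rw [inducedBasis_cons' D b a h j]
      exact L.smul_mem _ (hinr ⟨⟨_, a⟩, h⟩ ih)
  rw [eq_top_iff]
  intro w _
  have hw : w ∈ Submodule.span k (Set.range (D.inducedBasis (d := d) b)) := by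
    rw [Module.Basis.span_eq]; trivial
  refine (Submodule.span_le (p := L.restrictScalars k)).2 ?_ hw
  rintro _ ⟨a | a, rfl⟩
  · exact hinl a.2
  · exact hinr a (hinl _)

section extension

variable {M : Type u} [AddCommGroup M] [Module k M] [Module S M]
  {θ : M →ₗ[k] M} (f : N →ₗ[S] M)

omit hb in
variable (θ b) in
/-- The value of a word in a module with swap. -/
def evalLetter : {x : V} → D.Letter d x → M
  | _, .gen i => f (b i)
  | _, .cons (x := x) a _ j => (D.projBasis (D.E x) (some j) : S) • θ (evalLetter a)

lemma e_smul_evalLetter {x : V} (a : D.Letter d x) :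
    D.e x • D.evalLetter b θ f a = D.evalLetter b θ f a := by
  cases a with
  | gen i => rw [evalLetter, ← map_smul, hb i]
  | cons a h j =>
    rw [evalLetter, smul_smul]
    exact congrArg (· • _) (congrArg Subtype.val (D.e_smul_projBasis_some j))

/-- The universal property of the induced module: a map from `N` to a module with swap extends
to the induced module. -/
lemma exists_extension [IsScalarTower k S N] [IsScalarTower k S M] (hθ : D.IsSwap θ) :
    ∃ φ : D.Induced d N →ₗ[S] M, (∀ w, φ (D.inducedSwap b w) = θ (φ w)) ∧
      ∀ n, φ (LinearMap.inl S N _ n) = f n := by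
  classical
  let φ : D.Induced d N →ₗ[S] M := f.coprod (DFinsupp.lsum ℕ fun a : D.FreeLetters d =>
    (LinearMap.toSpanSingleton S M (θ (D.evalLetter b θ f a.1.2))).comp (Submodule.subtype _))
  have hinr (a : D.FreeLetters d) :
      φ (D.inducedBasis b (Sum.inr a)) = θ (D.evalLetter b θ f a.1.2) := by
    rw [inducedBasis_inr]
    simp only [φ, LinearMap.coprod_apply, map_zero, zero_add, DFinsupp.lsum_single]
    change D.e (D.E a.1.1) • θ _ = _
    rw [← hθ.map_smul, D.e_smul_evalLetter hb]
  have hinl (a : D.Letters d) :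
      φ (D.inducedBasis b (Sum.inl a)) = D.evalLetter b θ f a.2 := by
    obtain ⟨_, i | ⟨a, h, j⟩⟩ := a
    · rw [inducedBasis_gen]
      simp [φ, evalLetter]
    · rw [inducedBasis_cons' D b a h j, map_smul, hinr]
      rfl
  refine ⟨φ, fun w => ?_, fun n => by simp [φ]⟩
  have : (φ.restrictScalars k).comp (D.inducedSwap b) = θ.comp (φ.restrictScalars k) :=
    (D.inducedBasis (d := d) b).ext fun β => by
      change φ (D.inducedSwap b _) = θ (φ _)
      rw [inducedSwap_basis]
      obtain a | a := β
      · by_cases h : D.E a.1 = a.1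
        · rw [inducedPerm_inl_of_fixed _ _ _ h, hinl, ← D.e_smul_evalLetter hb, hθ.fixed _ _ h]
        · rw [D.inducedPerm_inl d ⟨a, h⟩, hinr, hinl]
      · rw [inducedPerm_inr, hinl, hinr, hθ.sq]
  exact LinearMap.congr_fun this w

end extension

end GluedAlgebra

/-! ### Counting words -/

namespace GluedAlgebra

variable {k : Type v} {S Λ V O : Type u} [Field k] [Ring S] [Algebra k S] [Ring Λ]
    [Algebra k Λ] [Fintype V] [Fintype O] (D : GluedAlgebra k S Λ V O)

section words

variable {ι : Type u} (d : ι → V)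

variable {D d} in
/-- The first letter of a word, and the word as a word over this letter alone. -/
def Letter.split : {x : V} → D.Letter d x → Σ i, D.Letter (fun _ : PUnit.{u + 1} => d i) x
  | _, .gen i => ⟨i, .gen (d := fun _ => d i) PUnit.unit⟩
  | _, .cons a h j => ⟨a.split.1, .cons a.split.2 h j⟩

variable {D d} in
/-- A word over one letter, as a word over all letters. -/
def Letter.join (i : ι) : {x : V} → D.Letter (fun _ : PUnit.{u + 1} => d i) x → D.Letter d x
  | _, .gen _ => .gen i
  | _, .cons a h j => .cons (a.join i) h j

lemma Letter.join_split {x : V} (a : D.Letter d x) : a.split.2.join a.split.1 = a := by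
  induction a with
  | gen i => rfl
  | cons a h j ih => simp only [split, join, ih]

lemma Letter.split_join (i : ι) {x : V} (a : D.Letter (fun _ : PUnit.{u + 1} => d i) x) :
    (a.join i).split = ⟨i, a⟩ := by
  induction a with
  | gen i => rfl
  | cons a h j ih => simp only [split, join]; rw [ih]

/-- Words are sorted by their first letter. -/
def splitEquiv :
    D.InducedIndex d ≃ Σ i, D.InducedIndex (fun _ : PUnit.{u + 1} => d i) where
  toFun
    | Sum.inl a => ⟨a.2.split.1, Sum.inl ⟨a.1, a.2.split.2⟩⟩
    | Sum.inr a => ⟨a.1.2.split.1, Sum.inr ⟨⟨a.1.1, a.1.2.split.2⟩, a.2⟩⟩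
  invFun
    | ⟨i, Sum.inl a⟩ => Sum.inl ⟨a.1, a.2.join i⟩
    | ⟨i, Sum.inr a⟩ => Sum.inr ⟨⟨a.1.1, a.1.2.join i⟩, a.2⟩
  left_inv := by
    rintro (⟨x, a⟩ | ⟨⟨x, a⟩, h⟩)
    · simp only [Letter.join_split]
    · simp only [Letter.join_split]
  right_inv := by
    rintro ⟨i, ⟨x, a⟩ | ⟨⟨x, a⟩, h⟩⟩
    · exact congrArg (fun p : Σ i, D.Letter (fun _ : PUnit.{u + 1} => d i) x =>
        (⟨p.1, Sum.inl ⟨x, p.2⟩⟩ : Σ i, D.InducedIndex (fun _ : PUnit.{u + 1} => d i)))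
        (Letter.split_join D d i a)
    · exact congrArg (fun p : Σ i, D.Letter (fun _ : PUnit.{u + 1} => d i) x =>
        (⟨p.1, Sum.inr ⟨⟨x, p.2⟩, h⟩⟩ : Σ i, D.InducedIndex (fun _ : PUnit.{u + 1} => d i)))
        (Letter.split_join D d i a)

/-- The number of basis elements of the induced module which come from one basis element of
degree `x`. -/
def wordCount (x : V) : ℕ := Nat.card (D.InducedIndex (fun _ : PUnit.{u + 1} => x))

lemma finite_inducedIndex_component [Finite (D.InducedIndex d)] (i : ι) :
    Finite (D.InducedIndex (fun _ : PUnit.{u + 1} => d i)) :=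
  Finite.of_injective (fun β => (D.splitEquiv d).symm ⟨i, β⟩)
    ((D.splitEquiv d).symm.injective.comp sigma_mk_injective)

/-- The basis of the induced module is sorted by the first letter. -/
lemma card_inducedIndex [Fintype ι] [Finite (D.InducedIndex d)] :
    Nat.card (D.InducedIndex d) = ∑ i, D.wordCount (d i) := by
  have := D.finite_inducedIndex_component d
  rw [Nat.card_congr (D.splitEquiv d), Nat.card_sigma]
  rfl

variable {D} {z : V}

/-- Removing the first letter of a word over one letter. The result is `none` for the word of
length one. -/
def Letter.tail : {x : V} → D.Letter (fun _ : PUnit.{u + 1} => z) x →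
    Option (D.Letter (fun j : D.J (D.E z) => tgt j) x)
  | _, .gen _ => none
  | _, .cons (.gen _) _ j => some (.gen (d := fun j : D.J (D.E z) => tgt j) j)
  | _, .cons (.cons a h' j') h j => (tail (.cons a h' j')).map fun a' => .cons a' h j

/-- Adding a first letter of degree `z ≠ E z` to a word. -/
def Letter.graft (hz : D.E z ≠ z) : {x : V} →
    D.Letter (fun j : D.J (D.E z) => tgt j) x → D.Letter (fun _ : PUnit.{u + 1} => z) x
  | _, .gen j => .cons (.gen (d := fun _ : PUnit.{u + 1} => z) PUnit.unit) hz j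
  | _, .cons a h j => .cons (a.graft hz) h j

lemma Letter.tail_graft (hz : D.E z ≠ z) {x : V}
    (a : D.Letter (fun j : D.J (D.E z) => tgt j) x) : (a.graft hz).tail = some a := by
  induction a with
  | gen j => rfl
  | cons a h j ih =>
    cases a with
    | gen j' => rfl
    | cons a h' j' =>
      simp only [graft, tail] at ih ⊢
      rw [ih]
      rfl

lemma Letter.graft_of_tail (hz : D.E z ≠ z) {x : V} (a : D.Letter (fun _ : PUnit.{u + 1} => z) x)
    (a' : D.Letter (fun j : D.J (D.E z) => tgt j) x) (h : a.tail = some a') :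
    a'.graft hz = a := by
  induction a with
  | gen _ => simp [tail] at h
  | cons a h' j ih =>
    cases a with
    | gen _ =>
      simp only [tail, Option.some.injEq] at h
      subst h
      rfl
    | cons a h'' j' =>
      simp only [tail, Option.map_eq_some_iff] at h
      obtain ⟨a'', h₁, rfl⟩ := h
      simp only [graft, ih a'' h₁]

lemma Letter.eq_gen_of_tail {x : V} (a : D.Letter (fun _ : PUnit.{u + 1} => z) x)
    (h : a.tail = none) :
    (⟨x, a⟩ : D.Letters _) = ⟨z, .gen (d := fun _ : PUnit.{u + 1} => z) PUnit.unit⟩ := by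
  induction a with
  | gen _ => rfl
  | cons a h' j ih =>
    cases a with
    | gen _ => simp [tail] at h
    | cons a h'' j' =>
      simp only [tail, Option.map_eq_none_iff] at h
      have := congrArg (D.lettersEquiv _) (ih h)
      simp [lettersEquiv] at this

variable (D)

/-- The basis of the module induced from one basis element of degree `z ≠ E z` consists of this
element, its swap, and the basis elements whose word continues with a basis element of
`S e_{E z}`. -/
def graftEquiv (hz : D.E z ≠ z) :
    D.InducedIndex (fun _ : PUnit.{u + 1} => z) ≃
      Option (Option (D.InducedIndex (fun j : D.J (D.E z) => tgt j))) where
  toFun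
    | Sum.inl a => a.2.tail.elim none fun a' => some (some (Sum.inl ⟨a.1, a'⟩))
    | Sum.inr a => a.1.2.tail.elim (some none) fun a' => some (some (Sum.inr ⟨⟨a.1.1, a'⟩, a.2⟩))
  invFun
    | none => Sum.inl ⟨z, .gen (d := fun _ : PUnit.{u + 1} => z) PUnit.unit⟩
    | some none => Sum.inr ⟨⟨z, .gen (d := fun _ : PUnit.{u + 1} => z) PUnit.unit⟩, hz⟩
    | some (some (Sum.inl a)) => Sum.inl ⟨a.1, a.2.graft hz⟩
    | some (some (Sum.inr a)) => Sum.inr ⟨⟨a.1.1, a.1.2.graft hz⟩, a.2⟩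
  left_inv := by
    rintro (⟨x, a⟩ | ⟨⟨x, a⟩, h⟩)
    · rcases ha : a.tail with _ | a'
      · simp only [ha, Option.elim_none, a.eq_gen_of_tail ha]
      · simp only [ha, Option.elim_some, a.graft_of_tail hz a' ha]
    · rcases ha : a.tail with _ | a'
      · simp only [ha, Option.elim_none, a.eq_gen_of_tail ha]
      · simp only [ha, Option.elim_some, a.graft_of_tail hz a' ha]
  right_inv := by
    rintro (_ | _ | ⟨x, a⟩ | ⟨⟨x, a⟩, h⟩)
    · rfl
    · rfl
    · simp only [Letter.tail_graft, Option.elim_some]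
    · simp only [Letter.tail_graft, Option.elim_some]

/-- If `z ≠ E z`, then the module induced from one basis element of degree `z` is spanned by this
element, its swap, and the words that continue with a basis element of `S e_{E z}`. -/
lemma wordCount_eq (hz : D.E z ≠ z) [Fintype (D.J (D.E z))]
    [Finite (D.InducedIndex (fun _ : PUnit.{u + 1} => z))] :
    D.wordCount z = 2 + ∑ j : D.J (D.E z), D.wordCount (tgt j) := by
  have : Finite (D.InducedIndex (fun j : D.J (D.E z) => tgt j)) :=
    Finite.of_injective (fun β => (D.graftEquiv hz).symm (some (some β)))
      ((D.graftEquiv hz).symm.injective.comp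
        ((Option.some_injective _).comp (Option.some_injective _)))
  have h := D.card_inducedIndex (fun j : D.J (D.E z) => tgt j)
  rw [wordCount, Nat.card_congr (D.graftEquiv hz), Finite.card_option,
    Finite.card_option, h]
  omega

lemma wordCount_of_fixed (hz : D.E z = z) : D.wordCount z = 1 := by
  have h₁ {x : V} (a : D.Letter (fun _ : PUnit.{u + 1} => z) x) :
      x = z ∧ (⟨x, a⟩ : D.Letters _) = ⟨z, .gen (d := fun _ : PUnit.{u + 1} => z) PUnit.unit⟩ := by
    induction a with
    | gen _ => exact ⟨rfl, rfl⟩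
    | cons a h j ih => rw [ih.1] at h; exact absurd hz h
  rw [wordCount, Nat.card_eq_one_iff_unique]
  refine ⟨⟨?_⟩, ⟨Sum.inl ⟨z, .gen (d := fun _ : PUnit.{u + 1} => z) PUnit.unit⟩⟩⟩
  have h₂ (β : D.InducedIndex (fun _ : PUnit.{u + 1} => z)) :
      β = Sum.inl ⟨z, .gen (d := fun _ : PUnit.{u + 1} => z) PUnit.unit⟩ := by
    obtain ⟨x, a⟩ | ⟨⟨x, a⟩, h⟩ := β
    · rw [(h₁ a).2]
    · exact absurd hz ((h₁ a).1 ▸ h)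
  intro β β'
  rw [h₂ β, h₂ β']

end words

section dimension

variable (k) {N : Type*} [AddCommGroup N] [Module k N] [Module S N] [IsScalarTower k S N]

/-- The subspace `e x N` of an `S`-module. -/
def component (x : V) (N : Type*) [AddCommGroup N] [Module k N] [Module S N]
    [IsScalarTower k S N] : Submodule k N where
  carrier := { n | D.e x • n = n }
  add_mem' ha hb := (smul_add _ _ _).trans (congrArg₂ _ ha hb)
  zero_mem' := smul_zero _
  smul_mem' c n hn := (smul_algebra_smul_comm c _ n).trans (congrArg _ hn)

variable {k} {D}

lemma mem_component {x : V} {n : N} : n ∈ D.component k x N ↔ D.e x • n = n := Iff.rfl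

lemma finrank_component {ι : Type*} [Fintype ι] [DecidableEq V] {d : ι → V}
    {b : Module.Basis ι k N} (hb : D.IsHomogeneous b d) (x : V) :
    Module.finrank k (D.component k x N) = (Finset.univ.filter fun i => d i = x).card := by
  have h : D.component k x N =
      Submodule.span k (Set.range (b ∘ Subtype.val (p := fun i => d i = x))) := by
    apply le_antisymm
    · intro n hn
      rw [mem_component] at hn
      rw [← hn, ← b.sum_repr n, Finset.smul_sum]
      refine Submodule.sum_mem _ fun i _ => ?_
      rw [smul_algebra_smul_comm]
      refine Submodule.smul_mem _ _ ?_
      by_cases hi : d i = x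
      · have hbi : D.e x • b i = b i := hi ▸ hb i
        rw [hbi]
        exact Submodule.subset_span ⟨⟨i, hi⟩, rfl⟩
      · rw [← hb i, D.e_smul_of_ne (Ne.symm hi)]
        exact Submodule.zero_mem _
    · rw [Submodule.span_le]
      rintro _ ⟨⟨i, rfl⟩, rfl⟩
      exact hb i
  rw [h, finrank_span_eq_card (b.linearIndependent.comp _ Subtype.val_injective),
    Fintype.card_subtype]

/-- Summation over the elements of a homogeneous basis. -/
lemma sum_homogeneous {ι : Type*} [Fintype ι] {d : ι → V}
    {b : Module.Basis ι k N} (hb : D.IsHomogeneous b d) (f : V → ℕ) :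
    ∑ i, f (d i) = ∑ x, f x * Module.finrank k (D.component k x N) := by
  classical
  rw [← Finset.sum_fiberwise Finset.univ d]
  refine Finset.sum_congr rfl fun x _ => ?_
  rw [finrank_component hb, Finset.sum_congr rfl (g := fun _ => f x) fun i hi => by
    rw [(Finset.mem_filter.1 hi).2], Finset.sum_const, smul_eq_mul, mul_comm]

variable {N' N'' : Type*} [AddCommGroup N'] [Module k N'] [Module S N'] [IsScalarTower k S N']
  [AddCommGroup N''] [Module k N''] [Module S N''] [IsScalarTower k S N'']

lemma finrank_component_of_exact [FiniteDimensional k N] (f : N' →ₗ[S] N) (g : N →ₗ[S] N'')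
    (hf : Function.Injective f) (hg : Function.Surjective g) (h : Function.Exact f g) (x : V) :
    Module.finrank k (D.component k x N) =
      Module.finrank k (D.component k x N') + Module.finrank k (D.component k x N'') := by
  let f' : D.component k x N' →ₗ[k] D.component k x N := (f.restrictScalars k).restrict
    fun n hn => by
      rw [mem_component] at hn ⊢
      rw [LinearMap.restrictScalars_apply, ← map_smul, hn]
  let g' : D.component k x N →ₗ[k] D.component k x N'' := (g.restrictScalars k).restrict
    fun n hn => by
      rw [mem_component] at hn ⊢
      rw [LinearMap.restrictScalars_apply, ← map_smul, hn]
  have hf' : Function.Injective f' := fun a b hab => Subtype.ext (hf (congrArg Subtype.val hab))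
  have hg' : Function.Surjective g' := by
    rintro ⟨n, hn⟩
    obtain ⟨m, rfl⟩ := hg n
    refine ⟨⟨D.e x • m, D.e_smul_self x m⟩, Subtype.ext ?_⟩
    exact (map_smul g _ _).trans hn
  have hex : LinearMap.range f' = LinearMap.ker g' := by
    ext ⟨n, hn⟩
    constructor
    · rintro ⟨m, hm⟩
      rw [LinearMap.mem_ker, ← hm]
      exact Subtype.ext ((h _).2 ⟨m.1, rfl⟩)
    · intro hn'
      obtain ⟨m, rfl⟩ := (h n).1 (congrArg Subtype.val (LinearMap.mem_ker.1 hn'))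
      refine ⟨⟨m, hf ?_⟩, rfl⟩
      rw [map_smul]
      exact hn
  rw [← LinearMap.finrank_range_add_finrank_ker g', ← hex, LinearMap.finrank_range_of_inj hf',
    LinearMap.range_eq_top.2 hg', finrank_top, add_comm]

/-- A swap identifies the components at `x` and `E x`. -/
lemma IsSwap.finrank_component {W : Type u} [AddCommGroup W] [Module k W] [Module S W]
    [IsScalarTower k S W] {θ : W →ₗ[k] W} (hθ : D.IsSwap θ) (x : V) :
    Module.finrank k (D.component k (D.E x) W) = Module.finrank k (D.component k x W) := by
  have h (y : V) (w : W) (hw : w ∈ D.component k y W) : θ w ∈ D.component k (D.E y) W := by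
    rw [mem_component] at hw ⊢
    rw [← hθ.map_smul, hw]
  exact LinearEquiv.finrank_eq
    { toFun := fun w => ⟨θ w.1, by simpa only [E_E] using h _ _ w.2⟩
      invFun := fun w => ⟨θ w.1, h _ _ w.2⟩
      left_inv := fun w => Subtype.ext (hθ.sq _)
      right_inv := fun w => Subtype.ext (hθ.sq _)
      map_add' := fun a b => Subtype.ext (map_add θ _ _)
      map_smul' := fun c a => Subtype.ext (_root_.map_smul θ _ _) }

/-- Summation over the set `V` orbit by orbit. -/
lemma sum_eq_sum_orbits [DecidableEq V] (f : V → ℕ) :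
    ∑ x, f x = ∑ o, (f (D.r o) + if D.E (D.r o) = D.r o then 0 else f (D.E (D.r o))) := by
  classical
  rw [← Finset.sum_fiberwise Finset.univ D.q]
  refine Finset.sum_congr rfl fun o _ => ?_
  have : (Finset.univ.filter fun x => D.q x = o) = {D.r o, D.E (D.r o)} := by
    ext x
    simp only [Finset.mem_filter, Finset.mem_univ, true_and, Finset.mem_insert,
      Finset.mem_singleton]
    nth_rw 1 [← D.q_r o]
    exact D.q_eq_iff _ _
  rw [this]
  split_ifs with h
  · simp [h]
  · rw [Finset.sum_pair (Ne.symm h)]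

end dimension

end GluedAlgebra

/-! ### Induction -/

namespace GluedAlgebra

variable {k : Type v} {S Λ V O : Type u} [Field k] [Ring S] [Algebra k S] [Ring Λ]
    [Algebra k Λ] [Fintype V] [Fintype O] (D : GluedAlgebra k S Λ V O)

instance (z : V) : Module.Projective S (D.proj z) :=
  Module.Projective.of_split (Submodule.subtype _) (LinearMap.toSpanSingleton S _ (D.projGen z))
    (LinearMap.ext fun s => D.smul_projGen s)

section Ind

variable (N : Type u) [AddCommGroup N] [Module k N] [Module S N] [IsScalarTower k S N]

/-- The index set of a homogeneous basis of `N`. -/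
def homIndex : Type u := (D.exists_homogeneous_basis (k := k) N).choose

/-- A homogeneous basis of `N`. -/
def homBasis : Module.Basis (D.homIndex N) k N :=
  (D.exists_homogeneous_basis (k := k) N).choose_spec.choose

/-- The degrees of a homogeneous basis of `N`. -/
def homDeg : D.homIndex N → V :=
  (D.exists_homogeneous_basis (k := k) N).choose_spec.choose_spec.choose

omit [IsScalarTower k S N] in
lemma isHomogeneous_homBasis : D.IsHomogeneous (D.homBasis N) (D.homDeg N) :=
  (D.exists_homogeneous_basis (k := k) N).choose_spec.choose_spec.choose_spec

lemma isSwap_homBasis : D.IsSwap (D.inducedSwap (d := D.homDeg N) (D.homBasis N)) :=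
  D.isSwap_inducedSwap (D.isHomogeneous_homBasis N)

/-- The `Λ`-module induced from an `S`-module `N`. -/
def Ind : Type u := Fixed (D.isSwap_homBasis N)

namespace Ind

instance : AddCommGroup (D.Ind N) :=
  inferInstanceAs (AddCommGroup (Fixed (D.isSwap_homBasis N)))
instance : Module k (D.Ind N) :=
  inferInstanceAs (Module k (Fixed (D.isSwap_homBasis N)))
instance : Module Λ (D.Ind N) :=
  inferInstanceAs (Module Λ (Fixed (D.isSwap_homBasis N)))
instance : IsScalarTower k Λ (D.Ind N) :=
  inferInstanceAs (IsScalarTower k Λ (Fixed (D.isSwap_homBasis N)))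

/-- The unit of the adjunction between induction and pullback. -/
def unit : N →ₗ[S] D.Pullback (D.Ind N) :=
  (Fixed.toPullback (D.isSwap_homBasis N)).comp
    (LinearMap.inl S N _)

lemma unit_injective : Function.Injective (unit D N) :=
  (Fixed.toPullback_bijective _).1.comp LinearMap.inl_injective

/-- The pullback of the induced module is the sum of `N` and modules `S e_z`. -/
lemma projective_quotient_range_unit :
    Module.Projective S (D.Pullback (D.Ind N) ⧸ LinearMap.range (unit D N)) := by
  let e : D.Induced (D.homDeg N) N ≃ₗ[S] D.Pullback (D.Ind N) :=
    Fixed.equivPullback (D.isSwap_homBasis N)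
  let π := (LinearMap.snd S N (Π₀ a : D.FreeLetters (D.homDeg N), D.proj (D.E a.1.1))).comp
    e.symm.toLinearMap
  have hπ : Function.Surjective π := fun p =>
    ⟨e (0, p), congrArg Prod.snd (e.symm_apply_apply (0, p))⟩
  have hker : LinearMap.ker π = LinearMap.range (unit D N) := by
    ext w
    obtain ⟨w, rfl⟩ := e.surjective w
    rw [LinearMap.mem_ker]
    change (e.symm (e w)).2 = 0 ↔ _
    rw [e.symm_apply_apply]
    constructor
    · intro h
      exact ⟨w.1, congrArg e (Prod.ext rfl h.symm)⟩
    · rintro ⟨n, hn⟩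
      rw [← e.injective hn]
      rfl
  rw [← hker]
  exact Module.Projective.of_equiv (LinearMap.quotKerEquivOfSurjective π hπ).symm

variable {N} {X : Type u} [AddCommGroup X] [Module Λ X]

/-- The universal property of the induced module. -/
lemma exists_lift [Module k X] [IsScalarTower k Λ X] (f : N →ₗ[S] D.Pullback X) :
    ∃ g : D.Ind N →ₗ[Λ] X, ∀ n, Pullback.map g (unit D N n) = f n := by
  obtain ⟨φ, hφ, hf⟩ := D.exists_extension (D.isHomogeneous_homBasis N) f
    (Pullback.isSwap D (X := X))
  exact ⟨Fixed.lift (hθ := D.isSwap_homBasis N) φ hφ, fun n =>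
    (Fixed.map_lift φ hφ _).trans (hf n)⟩

variable {D} in
lemma hom_ext {g g' : D.Ind N →ₗ[Λ] X}
    (h : ∀ n, Pullback.map g (unit D N n) = Pullback.map g' (unit D N n)) : g = g' :=
  Fixed.hom_ext_of_generated (D.isSwap_homBasis N) (LinearMap.inl S N _)
    (fun L h₁ h₂ => D.induced_generated L h₁ h₂) h

instance [FiniteDimensional k N] : Module.Finite Λ (D.Ind N) :=
  Fixed.finite_of_generated (D.isSwap_homBasis N) (LinearMap.inl S N _)
    fun L h₁ h₂ => D.induced_generated L h₁ h₂

variable [FiniteDimensional k Λ]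

instance [FiniteDimensional k N] : FiniteDimensional k (D.Ind N) := Module.Finite.trans Λ _

/-- There are only finitely many words: the induced module is finitely generated over the
finite-dimensional algebra `Λ`. -/
lemma _root_.GluedAlgebra.finite_inducedIndex [FiniteDimensional k N] {ι : Type u} {d : ι → V}
    {b : Module.Basis ι k N} (hb : D.IsHomogeneous b d) : Finite (D.InducedIndex d) := by
  have h := D.isSwap_inducedSwap hb
  have : Module.Finite Λ (Fixed h) :=
    Fixed.finite_of_generated _ (LinearMap.inl S N _) fun L h₁ h₂ => D.induced_generated L h₁ h₂
  have : FiniteDimensional k (Fixed h) := Module.Finite.trans Λ _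
  have : FiniteDimensional k (D.Induced d N) :=
    Module.Finite.equiv ((Fixed.equivPullback h).restrictScalars k).symm
  exact Module.Finite.finite_basis (D.inducedBasis (d := d) b)

/-- The dimension of the induced module depends only on the degrees of a homogeneous basis. -/
lemma finrank_pullback [FiniteDimensional k N] {ι : Type*} [Fintype ι] {d : ι → V}
    {b : Module.Basis ι k N} (hb : D.IsHomogeneous b d) :
    Module.finrank k (D.Pullback (D.Ind N)) = ∑ i, D.wordCount (d i) := by
  rw [sum_homogeneous hb]
  have hb' := D.isHomogeneous_homBasis N
  have := D.finite_inducedIndex hb'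
  have := Module.Finite.finite_basis (D.homBasis N)
  have := Fintype.ofFinite (D.homIndex N)
  rw [← sum_homogeneous hb', ← card_inducedIndex, ← Module.finrank_eq_nat_card_basis
    (D.inducedBasis (d := D.homDeg N) (D.homBasis N))]
  exact ((Fixed.equivPullback (D.isSwap_homBasis N)).restrictScalars k).finrank_eq.symm

end Ind

end Ind

end GluedAlgebra

/-! ### Exactness of induction and the kernel of the counit -/

namespace GluedAlgebra

variable {k : Type v} {S Λ V O : Type u} [Field k] [Ring S] [Algebra k S] [Ring Λ]
    [Algebra k Λ] [Fintype V] [Fintype O] {D : GluedAlgebra k S Λ V O}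

namespace Pullback

variable {X Y Z : Type u} [AddCommGroup X] [Module Λ X] [AddCommGroup Y] [Module Λ Y]
  [AddCommGroup Z] [Module Λ Z]

lemma injective_map {g : X →ₗ[Λ] Y} (hg : Function.Injective g) :
    Function.Injective (map (D := D) g) := fun a b h => by
  ext x
  exact hg (congrArg (fun f => f.val x) h)

lemma injective_of_map {g : X →ₗ[Λ] Y} (hg : Function.Injective (map (D := D) g)) :
    Function.Injective g := fun a b h => by
  apply spread_injective (D := D)
  apply hg
  rw [map_spread, map_spread, h]

lemma surjective_of_map {g : X →ₗ[Λ] Y} (hg : Function.Surjective (map (D := D) g)) :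
    Function.Surjective g := fun a => by
  obtain ⟨f, hf⟩ := hg (spread a)
  refine ⟨∑ o, f.val (D.r o), ?_⟩
  rw [map_sum, ← sum_spread (D := D) a, ← hf]
  rfl

lemma exact_map {f : X →ₗ[Λ] Y} {g : Y →ₗ[Λ] Z} (h : Function.Exact f g) :
    Function.Exact (map (D := D) f) (map g) := by
  intro w
  constructor
  · intro hw
    choose a ha using fun x => (h (w.val x)).1 (congrArg (fun f => f.val x) hw)
    refine ⟨mk (fun x => D.γ (D.e x) • a x) fun x => by rw [smul_smul, γ_e_mul_self], ?_⟩
    ext x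
    rw [map_val, mk_val, map_smul, ha, e_smul_val]
  · rintro ⟨w, rfl⟩
    ext x
    exact h.apply_apply_eq_zero _

lemma finrank_of_exact [FiniteDimensional k (D.Pullback Y)] {f : X →ₗ[Λ] Y} {g : Y →ₗ[Λ] Z}
    (hf : Function.Injective f) (hg : Function.Surjective g) (h : Function.Exact f g) :
    Module.finrank k (D.Pullback Y) =
      Module.finrank k (D.Pullback X) + Module.finrank k (D.Pullback Z) := by
  let f' := (map (D := D) f).restrictScalars k
  let g' := (map (D := D) g).restrictScalars k
  have hex : LinearMap.ker g' = LinearMap.range f' :=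
    (LinearMap.exact_iff (f := f') (g := g')).1 (exact_map h)
  rw [← LinearMap.finrank_range_add_finrank_ker g', hex,
    LinearMap.finrank_range_of_inj (f := f') (injective_map hf),
    (LinearMap.range_eq_top (f := g')).2 (map_surjective g hg), finrank_top, add_comm]

lemma finrank_le_of_surjective [FiniteDimensional k (D.Pullback X)] {g : X →ₗ[Λ] Y}
    (hg : Function.Surjective g) :
    Module.finrank k (D.Pullback Y) ≤ Module.finrank k (D.Pullback X) :=
  LinearMap.finrank_le_finrank_of_surjective (f := (map (D := D) g).restrictScalars k)
    (map_surjective g hg)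

/-- A surjection whose target is not smaller than its source, as measured by the pullbacks, is
injective. -/
lemma injective_of_surjective_of_finrank_le [FiniteDimensional k (D.Pullback X)]
    [FiniteDimensional k (D.Pullback Y)] {g : X →ₗ[Λ] Y} (hg : Function.Surjective g)
    (h : Module.finrank k (D.Pullback X) ≤ Module.finrank k (D.Pullback Y)) :
    Function.Injective g :=
  injective_of_map (D := D) <| (LinearMap.injective_iff_surjective_of_finrank_eq_finrank
    (f := (map (D := D) g).restrictScalars k) (h.antisymm (finrank_le_of_surjective hg))).2
    (map_surjective g hg)

end Pullback

namespace Ind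

variable {N N' : Type u} [AddCommGroup N] [Module k N] [Module S N] [IsScalarTower k S N]
  [AddCommGroup N'] [Module k N'] [Module S N'] [IsScalarTower k S N']

lemma projective [Module.Projective S N] : Module.Projective Λ (D.Ind N) := by
  refine Module.Projective.of_lifting_property'' fun f hf => ?_
  obtain ⟨s, hs⟩ := Module.projective_lifting_property (Pullback.map (D := D) f) (unit D N)
    (Pullback.map_surjective f hf)
  obtain ⟨h, hh⟩ := exists_lift D s
  refine ⟨h, hom_ext fun n => ?_⟩
  change Pullback.map f (Pullback.map h _) = _
  rw [hh]
  exact LinearMap.congr_fun hs n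

variable [FiniteDimensional k Λ]

lemma finrank_pullback_eq_sum [FiniteDimensional k N] :
    Module.finrank k (D.Pullback (D.Ind N)) =
      ∑ x, D.wordCount x * Module.finrank k (D.component k x N) := by
  have := Module.Finite.finite_basis (D.homBasis N)
  have := Fintype.ofFinite (D.homIndex N)
  rw [finrank_pullback D (D.isHomogeneous_homBasis N), sum_homogeneous (D.isHomogeneous_homBasis N)]

/-- Induction preserves injective maps: it is right exact, and by
`finrank_pullback_eq_sum` the dimension of the induced module is additive in short exact
sequences. -/
lemma injective_of_injective [FiniteDimensional k N] [FiniteDimensional k N'] (f : N' →ₗ[S] N)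
    (hf : Function.Injective f) (g : D.Ind N' →ₗ[Λ] D.Ind N)
    (hg : ∀ n, Pullback.map g (unit D N' n) = unit D N (f n)) : Function.Injective g := by
  let K := LinearMap.range g
  let Q := N ⧸ LinearMap.range f
  have hker : LinearMap.range f ≤
      LinearMap.ker ((Pullback.map (D := D) K.mkQ).comp (unit D N)) := by
    rintro _ ⟨n, rfl⟩
    rw [LinearMap.mem_ker, LinearMap.comp_apply, ← hg]
    ext x
    exact (Submodule.Quotient.mk_eq_zero K).2 ⟨_, rfl⟩
  -- By right exactness, the cokernel of `g` is a quotient of the module induced from `Q`.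
  obtain ⟨h, hh⟩ := exists_lift D (N := Q) ((LinearMap.range f).liftQ _ hker)
  obtain ⟨p, hp⟩ := exists_lift D ((unit D Q).comp (LinearMap.range f).mkQ)
  have hhp : h.comp p = K.mkQ := hom_ext fun n => by
    change Pullback.map h (Pullback.map p _) = _
    rw [hp, LinearMap.comp_apply, hh]
    exact Submodule.liftQ_apply _ _ _
  have hsurj : Function.Surjective h := by
    refine Function.Surjective.of_comp (g := p) ?_
    rw [← LinearMap.coe_comp, hhp]
    exact K.mkQ_surjective
  have h₁ : Module.finrank k (D.Pullback (D.Ind N)) =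
      Module.finrank k (D.Pullback (D.Ind N')) + Module.finrank k (D.Pullback (D.Ind Q)) := by
    simp only [finrank_pullback_eq_sum]
    rw [← Finset.sum_add_distrib]
    refine Finset.sum_congr rfl fun x _ => ?_
    rw [finrank_component_of_exact f (LinearMap.range f).mkQ hf (Submodule.mkQ_surjective _)
      (LinearMap.exact_map_mkQ_range f), mul_add]
  have h₂ := Pullback.finrank_of_exact (D := D) (k := k) K.injective_subtype K.mkQ_surjective
    (LinearMap.exact_subtype_mkQ K)
  have h₃ := Pullback.finrank_le_of_surjective (D := D) (k := k) hsurj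
  have : FiniteDimensional k K :=
    Module.Finite.of_injective (K.subtype.restrictScalars k) K.injective_subtype
  have h₄ : Function.Injective g.rangeRestrict :=
    Pullback.injective_of_surjective_of_finrank_le (D := D) (k := k) g.surjective_rangeRestrict
      (by change _ ≤ Module.finrank k (D.Pullback K); omega)
  exact K.injective_subtype.comp h₄

end Ind

section counit

variable {X : Type u} [AddCommGroup X] [Module k X] [Module Λ X] [IsScalarTower k Λ X]

variable [FiniteDimensional k X]

section relations

variable (D X)

/-- The index set of the relations between the elements of the module that is induced from the
pullback of `X`: for every orbit of length two, a basis of the component at its representative. -/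
abbrev RelIndex : Type u :=
  Σ o : { o : O // D.E (D.r o) ≠ D.r o },
    Fin (Module.finrank k (D.component k (D.r o) (D.Pullback X)))

/-- The projective `S`-module which induces the kernel of the counit at `X`. -/
abbrev Relations : Type u := Π₀ b : D.RelIndex X, D.proj (D.E (D.r b.1))

variable {D X}

/-- The basis element of the pullback of `X` to which a relation belongs. -/
def relBasis (b : D.RelIndex X) : D.Pullback X :=
  (Module.finBasis k (D.component k (D.r b.1) (D.Pullback X)) b.2 : D.Pullback X)

lemma e_smul_relBasis (b : D.RelIndex X) : D.e (D.r b.1) • relBasis b = relBasis b :=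
  (Module.finBasis k (D.component k (D.r b.1) (D.Pullback X)) b.2).2

open Classical in
/-- The relations say that the unit at the pullback of `X` commutes with the swap. -/
def rel : D.Relations X →ₗ[S] D.Pullback (D.Ind (D.Pullback X)) :=
  DFinsupp.lsum ℕ fun b => (LinearMap.toSpanSingleton S (D.Pullback (D.Ind (D.Pullback X)))
    (Pullback.swap D _ (Ind.unit D _ (relBasis b)) -
      Ind.unit D _ (Pullback.swap D X (relBasis b)))).comp (Submodule.subtype _)

open Classical in
lemma rel_single (b : D.RelIndex X) (s : D.proj (D.E (D.r b.1))) :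
    rel (DFinsupp.single b s) = (s : S) • (Pullback.swap D _ (Ind.unit D _ (relBasis b)) -
      Ind.unit D _ (Pullback.swap D X (relBasis b))) := by
  simp [rel]

open Classical in
lemma rel_single_projGen (b : D.RelIndex X) :
    rel (DFinsupp.single b (D.projGen _)) = Pullback.swap D _ (Ind.unit D _ (relBasis b)) -
      Ind.unit D _ (Pullback.swap D X (relBasis b)) := by
  rw [rel_single]
  change D.e _ • _ = _
  rw [smul_sub, ← (Pullback.isSwap D).map_smul, ← map_smul, ← map_smul,
    ← (Pullback.isSwap D).map_smul, e_smul_relBasis]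

/-- A map out of the module induced from the pullback of `X` which kills the relations factors
through the counit, as it comes from a map that commutes with the swap. -/
lemma map_swap_of_rel {Y : Type u} [AddCommGroup Y] [Module k Y] [Module Λ Y]
    [IsScalarTower k Λ Y] (g : D.Ind (D.Pullback X) →ₗ[Λ] Y)
    (hg : ∀ n : D.Relations X, Pullback.map g (rel n) = 0) (w : D.Pullback X) :
    Pullback.map g (Ind.unit D _ (Pullback.swap D X w)) =
      Pullback.swap D Y (Pullback.map g (Ind.unit D _ w)) := by
  classical
  let σ : D.Pullback X →ₗ[S] D.Pullback Y := (Pullback.map g).comp (Ind.unit D _)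
  change σ (Pullback.swap D X w) = Pullback.swap D Y (σ w)
  have key (o : O) (ho : D.E (D.r o) ≠ D.r o) (w : D.Pullback X) (hw : D.e (D.r o) • w = w) :
      σ (Pullback.swap D X w) = Pullback.swap D Y (σ w) := by
    have h : ((σ.restrictScalars k).comp (Pullback.swap D X)).comp
        (D.component k (D.r o) (D.Pullback X)).subtype =
        ((Pullback.swap D Y).comp (σ.restrictScalars k)).comp
        (D.component k (D.r o) (D.Pullback X)).subtype := by
      refine (Module.finBasis k (D.component k (D.r o) (D.Pullback X))).ext fun i => ?_
      have := hg (DFinsupp.single ⟨⟨o, ho⟩, i⟩ (D.projGen _))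
      rw [rel_single_projGen, map_sub, sub_eq_zero, Pullback.map_swap] at this
      exact this.symm
    exact LinearMap.congr_fun h ⟨w, hw⟩
  have hom (x : V) (w : D.Pullback X) (hw : D.e x • w = w) :
      σ (Pullback.swap D X w) = Pullback.swap D Y (σ w) := by
    by_cases hx : D.E x = x
    · rw [← hw, (Pullback.isSwap D).fixed _ _ hx, map_smul, (Pullback.isSwap D).fixed _ _ hx]
    · obtain h | h := (D.q_eq_iff x (D.r (D.q x))).1 (D.q_r _).symm
      · exact key (D.q x) (h ▸ hx) w (h ▸ hw)
      · have hr : D.E x = D.r (D.q x) := by rw [h, E_E, ← h]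
        have := key (D.q x) (by rw [← hr]; exact D.E_ne_iff.2 hx) (Pullback.swap D X w) (by
          rw [← hr, ← (Pullback.isSwap D).map_smul, hw])
        rw [(Pullback.isSwap D).sq] at this
        rw [this, (Pullback.isSwap D).sq]
  rw [← D.sum_e_smul w]
  simp only [map_sum]
  exact Finset.sum_congr rfl fun x _ => hom x _ (D.e_smul_self x w)

end relations

instance finite_J [FiniteDimensional k S] (z : V) : Finite (D.J z) := by
  have := Module.Finite.finite_basis (D.projBasis z)
  exact Finite.of_injective _ (Option.some_injective _)

lemma isHomogeneous_projBasis (z : V) :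
    D.IsHomogeneous (D.projBasis z) (fun j => j.elim z tgt) := by
  rintro (_ | j)
  · rw [projBasis_none]
    exact Subtype.ext (D.e_mul_self z)
  · exact D.e_smul_projBasis_some j

variable [FiniteDimensional k Λ]

lemma finite_inducedIndex_punit [FiniteDimensional k S] (z : V) :
    Finite (D.InducedIndex (fun _ : PUnit.{u + 1} => z)) := by
  have := D.finite_inducedIndex (D.isHomogeneous_projBasis z)
  exact D.finite_inducedIndex_component (fun j : Option (D.J z) => j.elim z tgt) none

/-- The sum of the word counts of a homogeneous basis of `S e_{E z}`. -/
lemma sum_wordCount_projBasis [FiniteDimensional k S] {z : V} (hz : D.E z ≠ z)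
    [Fintype (D.J (D.E z))] :
    ∑ j : Option (D.J (D.E z)), D.wordCount (j.elim (D.E z) tgt) + 2 =
      D.wordCount z + D.wordCount (D.E z) := by
  have := D.finite_inducedIndex_punit z
  rw [Fintype.sum_option, D.wordCount_eq hz]
  simp only [Option.elim_none, Option.elim_some]
  omega

variable [FiniteDimensional k S]

/-- The dimensions which an exact sequence from the module induced from the relations, over the
module induced from the pullback of `X`, to `X` requires. For each basis element of the pullback of
`X` in the component of a representative of an orbit of length two, it is
`sum_wordCount_projBasis`. -/
lemma finrank_pullback_relations :
    Module.finrank k (D.Pullback (D.Ind (D.Relations X))) + Module.finrank k (D.Pullback X) =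
      Module.finrank k (D.Pullback (D.Ind (D.Pullback X))) := by
  classical
  have (z : V) := Fintype.ofFinite (D.J z)
  let b := DFinsupp.basis fun b : D.RelIndex X => D.projBasis (D.E (D.r b.1))
  let d : (Σ b : D.RelIndex X, Option (D.J (D.E (D.r b.1)))) → V :=
    fun p => p.2.elim (D.E (D.r p.1.1)) tgt
  have hb : D.IsHomogeneous b d := by
    rintro ⟨i, j⟩
    simp only [b, DFinsupp.basis_apply, ← DFinsupp.single_smul]
    exact congrArg (DFinsupp.single i) (D.isHomogeneous_projBasis _ j)
  have : FiniteDimensional k (D.Relations X) := Module.Finite.of_basis b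
  have hX : Module.finrank k (D.Pullback X) =
      ∑ x, Module.finrank k (D.component k x (D.Pullback X)) := by
    have := Module.Finite.finite_basis (D.homBasis (D.Pullback X))
    have := Fintype.ofFinite (D.homIndex (D.Pullback X))
    have h := sum_homogeneous (D.isHomogeneous_homBasis (D.Pullback X)) fun _ => 1
    simp only [one_mul, Finset.sum_const, smul_eq_mul, mul_one] at h
    rw [← h, Module.finrank_eq_card_basis (D.homBasis (D.Pullback X)), Finset.card_univ]
  rw [Ind.finrank_pullback D hb, Ind.finrank_pullback_eq_sum, hX, Fintype.sum_sigma,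
    Fintype.sum_sigma,
    sum_eq_sum_orbits (D := D) fun x => Module.finrank k (D.component k x (D.Pullback X)),
    sum_eq_sum_orbits (D := D) fun x =>
      D.wordCount x * Module.finrank k (D.component k x (D.Pullback X))]
  change ∑ o : { o : O // D.E (D.r o) ≠ D.r o },
    ∑ _i : Fin (Module.finrank k (D.component k (D.r o) (D.Pullback X))),
    ∑ j : Option (D.J (D.E (D.r o))), D.wordCount (j.elim (D.E (D.r o)) tgt) + _ = _
  simp only [(Pullback.isSwap D).finrank_component, Finset.sum_const, Finset.card_univ,
    Fintype.card_fin, smul_eq_mul]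
  rw [← Finset.sum_subtype (Finset.univ.filter fun o => D.E (D.r o) ≠ D.r o) (by simp)
    fun o => Module.finrank k (D.component k (D.r o) (D.Pullback X)) *
      ∑ j : Option (D.J (D.E (D.r o))), D.wordCount (j.elim (D.E (D.r o)) tgt),
    Finset.sum_filter, ← Finset.sum_add_distrib]
  refine Finset.sum_congr rfl fun o _ => ?_
  by_cases h : D.E (D.r o) = D.r o
  · simp [h, D.wordCount_of_fixed h]
  · rw [if_pos h, if_neg h, if_neg h, ← add_mul, ← sum_wordCount_projBasis h]
    ring

/-- The counit at `X` has a projective kernel, namely the module induced from the projective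
`S`-module of relations. -/
lemma projective_ker_counit (ε : D.Ind (D.Pullback X) →ₗ[Λ] X)
    (hε : ∀ w, Pullback.map ε (Ind.unit D _ w) = w) :
    Module.Projective Λ (LinearMap.ker ε) := by
  classical
  obtain ⟨ψ, hψ⟩ := Ind.exists_lift D (rel (D := D) (X := X))
  let K := LinearMap.range ψ
  have hsurj : Function.Surjective ε := Pullback.surjective_of_map fun w => ⟨_, hε w⟩
  have hrel : (Pullback.map ε).comp (rel (D := D) (X := X)) = 0 :=
    DFinsupp.lhom_ext fun b s => by
      rw [LinearMap.comp_apply, rel_single, map_smul, map_sub, Pullback.map_swap, hε, hε,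
        sub_self, smul_zero, LinearMap.zero_apply]
  have hεψ : ε.comp ψ = 0 := Ind.hom_ext fun n => by
    change Pullback.map ε (Pullback.map ψ _) = _
    rw [hψ]
    exact LinearMap.congr_fun hrel n
  obtain ⟨g, hg⟩ := Pullback.exists_map_eq ((Pullback.map K.mkQ).comp (Ind.unit D _))
    (map_swap_of_rel K.mkQ fun n => by
      rw [← hψ]
      ext x
      exact (Submodule.Quotient.mk_eq_zero K).2 ⟨_, rfl⟩)
  -- The projection modulo `K` factors through `ε`, so that `ker ε ≤ K`.
  have hgε : g.comp ε = K.mkQ := Ind.hom_ext fun w => by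
    change Pullback.map g (Pullback.map ε _) = _
    rw [hε, hg]
    rfl
  have hK : LinearMap.ker ε = K := by
    apply le_antisymm
    · intro a ha
      rw [← K.ker_mkQ, LinearMap.mem_ker, ← hgε, LinearMap.comp_apply, LinearMap.mem_ker.1 ha,
        map_zero]
    · rintro _ ⟨a, rfl⟩
      exact LinearMap.congr_fun hεψ a
  have hex : Function.Exact K.subtype ε := by
    rw [LinearMap.exact_iff, hK, K.range_subtype]
  -- The dimension count shows that `ψ` is injective, hence an isomorphism onto `K = ker ε`.
  have h₁ := Pullback.finrank_of_exact (D := D) (k := k) K.injective_subtype hsurj hex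
  have h₂ := finrank_pullback_relations (D := D) (k := k) (X := X)
  have : FiniteDimensional k K :=
    Module.Finite.of_injective (K.subtype.restrictScalars k) K.injective_subtype
  have : FiniteDimensional k (D.Relations X) := inferInstance
  have h₃ : Function.Injective ψ.rangeRestrict :=
    Pullback.injective_of_surjective_of_finrank_le (D := D) (k := k) ψ.surjective_rangeRestrict
      (by change _ ≤ Module.finrank k (D.Pullback K); omega)
  have := Ind.projective (D := D) (N := D.Relations X)
  rw [hK]
  exact Module.Projective.of_equiv (LinearEquiv.ofBijective ψ.rangeRestrict
    ⟨h₃, ψ.surjective_rangeRestrict⟩)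

end counit

end GluedAlgebra

/-! ### Finitely generated modules and the singularity equivalence -/

namespace FGModuleCat

open CategoryTheory Limits

variable {R : Type u} [Ring R] [IsNoetherianRing R] {X Y : FGModuleCat.{u} R}

lemma mono_iff_injective (f : X ⟶ Y) : Mono f ↔ Function.Injective f.hom.hom := by
  rw [← ModuleCat.mono_iff_injective f.hom]
  exact ⟨fun _ => inferInstanceAs (Mono ((forget₂ (FGModuleCat R) (ModuleCat R)).map f)),
    fun h => (forget₂ (FGModuleCat R) (ModuleCat R)).mono_of_mono_map h⟩

lemma epi_iff_surjective (f : X ⟶ Y) : Epi f ↔ Function.Surjective f.hom.hom := by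
  rw [← ModuleCat.epi_iff_surjective f.hom]
  exact ⟨fun _ => inferInstanceAs (Epi ((forget₂ (FGModuleCat R) (ModuleCat R)).map f)),
    fun h => (forget₂ (FGModuleCat R) (ModuleCat R)).epi_of_epi_map h⟩

lemma projective_of (P : Type u) [AddCommGroup P] [Module R P] [Module.Finite R P]
    [Module.Projective R P] : Projective (FGModuleCat.of R P) where
  factors {E X} f e _ := by
    obtain ⟨h, hh⟩ := Module.projective_lifting_property e.hom.hom f.hom.hom
      ((epi_iff_surjective e).1 inferInstance)
    exact ⟨ofHom h, hom_ext hh⟩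

instance : EnoughProjectives (FGModuleCat.{u} R) where
  presentation X := by
    obtain ⟨n, f, hf⟩ := Module.Finite.exists_fin' R X
    have : Projective (FGModuleCat.of R (Fin n → R)) := projective_of _
    exact ⟨{ p := FGModuleCat.of R (Fin n → R)
             f := ofHom f
             epi := (epi_iff_surjective _).2 hf }⟩

lemma projective_cokernel (f : X ⟶ Y)
    (h : Module.Projective R (Y ⧸ LinearMap.range f.hom.hom)) : Projective (cokernel f) := by
  have hP := projective_of (R := R) (Y ⧸ LinearMap.range f.hom.hom)
  let π : Y ⟶ FGModuleCat.of R (Y ⧸ LinearMap.range f.hom.hom) :=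
    ofHom (LinearMap.range f.hom.hom).mkQ
  have hπ : f ≫ π = 0 := hom_ext (LinearMap.range_mkQ_comp f.hom.hom)
  have : Epi π := (epi_iff_surjective _).2 (Submodule.mkQ_surjective _)
  have hc : IsColimit (CokernelCofork.ofπ π hπ) := CokernelCofork.IsColimit.ofπ' π hπ
    fun {Z} t ht => ⟨ofHom ((LinearMap.range f.hom.hom).liftQ t.hom.hom (by
      rintro _ ⟨a, rfl⟩
      exact LinearMap.congr_fun (congrArg (fun φ => φ.hom.hom) ht) a)),
      hom_ext (Submodule.liftQ_mkQ _ _ _)⟩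
  exact Projective.of_iso ((cokernelIsCokernel f).coconePointUniqueUpToIso hc).symm hP

lemma projective_kernel (f : X ⟶ Y)
    (h : Module.Projective R (LinearMap.ker f.hom.hom)) : Projective (kernel f) := by
  have hP := projective_of (R := R) (LinearMap.ker f.hom.hom)
  let i : FGModuleCat.of R (LinearMap.ker f.hom.hom) ⟶ X := ofHom (LinearMap.ker f.hom.hom).subtype
  have hi : i ≫ f = 0 := hom_ext (LinearMap.comp_ker_subtype f.hom.hom)
  have : Mono i := (mono_iff_injective _).2 (Submodule.injective_subtype _)
  have hc : IsLimit (KernelFork.ofι i hi) := KernelFork.IsLimit.ofι' i hi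
    fun {Z} t ht => ⟨ofHom (t.hom.hom.codRestrict _ fun a =>
      LinearMap.congr_fun (congrArg (fun φ : Z ⟶ Y => φ.hom.hom) ht) a), rfl⟩
  exact Projective.of_iso ((kernelIsKernel f).conePointUniqueUpToIso hc).symm hP

end FGModuleCat

namespace GluedAlgebra

open CategoryTheory

variable {k : Type v} {S Λ V O : Type u} [Field k] [Ring S] [Algebra k S] [Ring Λ]
    [Algebra k Λ] [Fintype V] [Fintype O] (D : GluedAlgebra k S Λ V O)
    [FiniteDimensional k S] [FiniteDimensional k Λ]

open ModuleCat

instance {A : Type u} [Ring A] [Algebra k A] [FiniteDimensional k A] (X : FGModuleCat.{u} A) :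
    FiniteDimensional k X :=
  Module.Finite.trans A X

instance (X : FGModuleCat.{u} Λ) : Module.Finite S (D.Pullback X) :=
  Module.Finite.of_restrictScalars_finite k S _

/-- The pullback functor from finitely generated `Λ`-modules to finitely generated `S`-modules. -/
def pullbackFunctor : FGModuleCat.{u} Λ ⥤ FGModuleCat.{u} S where
  obj X := FGModuleCat.of S (D.Pullback X)
  map f := FGModuleCat.ofHom (Pullback.map f.hom.hom)

/-- The universal property of the induced module, as a bijection of morphism sets. -/
def indEquiv (N : FGModuleCat.{u} S) (X : FGModuleCat.{u} Λ) :
    (FGModuleCat.of Λ (D.Ind N) ⟶ X) ≃ (N ⟶ D.pullbackFunctor.obj X) :=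
  Equiv.ofBijective (fun g => FGModuleCat.ofHom (Pullback.map g.hom.hom ∘ₗ Ind.unit D N))
    ⟨fun g g' h => FGModuleCat.hom_ext <| Ind.hom_ext fun n => LinearMap.congr_fun
      (congrArg (fun φ : N ⟶ D.pullbackFunctor.obj X => φ.hom.hom) h) n, fun f => by
      obtain ⟨g, hg⟩ := Ind.exists_lift D f.hom.hom
      exact ⟨FGModuleCat.ofHom g, FGModuleCat.hom_ext (LinearMap.ext hg)⟩⟩

lemma indEquiv_comp (N : FGModuleCat.{u} S) (X Y : FGModuleCat.{u} Λ) (g : X ⟶ Y)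
    (h : FGModuleCat.of Λ (D.Ind N) ⟶ X) :
    D.indEquiv N Y (h ≫ g) = D.indEquiv N X h ≫ D.pullbackFunctor.map g := rfl

instance : D.pullbackFunctor.Additive where
  map_add {X Y f g} := by
    apply FGModuleCat.hom_ext
    ext w
    rfl

instance : D.pullbackFunctor.Faithful where
  map_injective {X Y _ _} h := FGModuleCat.hom_ext <| Pullback.map_injective (D := D)
    (congrArg (fun φ : D.pullbackFunctor.obj X ⟶ D.pullbackFunctor.obj Y => φ.hom.hom) h)

/-- The induction functor, left adjoint to the pullback functor. -/
def indFunctor : FGModuleCat.{u} S ⥤ FGModuleCat.{u} Λ :=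
  Adjunction.leftAdjointOfEquiv D.indEquiv D.indEquiv_comp

/-- Induction is left adjoint to pullback. -/
def indAdjunction : D.indFunctor ⊣ D.pullbackFunctor :=
  Adjunction.adjunctionOfEquivLeft D.indEquiv D.indEquiv_comp

lemma indAdjunction_unit_app (N : FGModuleCat.{u} S) :
    (D.indAdjunction.unit.app N).hom.hom = Ind.unit D N := by
  rw [indAdjunction, Adjunction.adjunctionOfEquivLeft_unit_app]
  rfl

lemma map_indAdjunction_counit_app (X : FGModuleCat.{u} Λ) (w : D.Pullback X) :
    Pullback.map (D.indAdjunction.counit.app X).hom.hom (Ind.unit D (D.Pullback X) w) = w := by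
  have h₁ := LinearMap.congr_fun (D.indAdjunction_unit_app (D.pullbackFunctor.obj X)) w
  have h₂ := LinearMap.congr_fun (congrArg
    (fun φ : D.pullbackFunctor.obj X ⟶ D.pullbackFunctor.obj X => φ.hom.hom)
    (D.indAdjunction.right_triangle_components X)) w
  exact (congrArg (Pullback.map (D.indAdjunction.counit.app X).hom.hom) h₁.symm).trans h₂

lemma map_indFunctor_map {N N' : FGModuleCat.{u} S} (f : N' ⟶ N) (n : N') :
    Pullback.map (D.indFunctor.map f).hom.hom (Ind.unit D N' n) = Ind.unit D N (f.hom.hom n) := by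
  have h := D.indAdjunction.unit.naturality f
  have := LinearMap.congr_fun (congrArg
    (fun φ : N' ⟶ D.pullbackFunctor.obj (D.indFunctor.obj N) => φ.hom.hom) h) n
  rw [← indAdjunction_unit_app, ← indAdjunction_unit_app]
  exact this.symm

variable [IsNoetherianRing S] [IsNoetherianRing Λ]

instance : D.pullbackFunctor.PreservesEpimorphisms where
  preserves f hf := (FGModuleCat.epi_iff_surjective _).2
    (Pullback.map_surjective f.hom.hom ((FGModuleCat.epi_iff_surjective f).1 hf))

instance : D.indFunctor.PreservesMonomorphisms where
  preserves f hf := (FGModuleCat.mono_iff_injective _).2 <|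
    Ind.injective_of_injective (D := D) (k := k) f.hom.hom
      ((FGModuleCat.mono_iff_injective f).1 hf) (D.indFunctor.map f).hom.hom
      (D.map_indFunctor_map f)

include D in
/-- A finite-dimensional algebra and its gluing along an involution are singularity
equivalent. -/
theorem singularityEquivalent [HasDerivedCategory.{w} (FGModuleCat.{u} S)]
    [HasDerivedCategory.{w'} (FGModuleCat.{u} Λ)] : SingularityEquivalent S Λ :=
  triangleEquivalent_of_faithful D.indAdjunction
    (fun N => (FGModuleCat.mono_iff_injective _).2 (by
      rw [indAdjunction_unit_app]
      exact Ind.unit_injective D N))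
    (fun N => FGModuleCat.projective_cokernel _ (by
      rw [indAdjunction_unit_app]
      exact Ind.projective_quotient_range_unit D N))
    (fun X => FGModuleCat.projective_kernel _
      (projective_ker_counit (D := D) (k := k) _ (D.map_indAdjunction_counit_app X)))

end GluedAlgebra

/-! ### Path algebras and gluing of quivers -/

namespace PathAlgebra

section lift

variable {k : Type u} {V : Type v} [Field k] [Quiver.{w} V] {A : Type*} [Ring A] [Algebra k A]

/-- The trivial path at a vertex, as an element of the path algebra. -/
def vertex (k : Type u) {V : Type v} [Field k] [Quiver.{w} V] (x : V) : PathAlgebra k V :=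
  ofPath k ⟨x, x, Quiver.Path.nil⟩

/-- An arrow, as an element of the path algebra. -/
def arrow (k : Type u) {V : Type v} [Field k] [Quiver.{w} V] {x y : V} (α : x ⟶ y) :
    PathAlgebra k V :=
  ofPath k ⟨x, y, α.toPath⟩

lemma vertex_mul_self (x : V) : vertex k x * vertex k x = vertex k x := ofPath_mul_comp _ _

lemma vertex_mul_of_ne {x y : V} (h : x ≠ y) : vertex k x * vertex k y = 0 :=
  ofPath_mul_of_ne _ _ h.symm

lemma vertex_mul_arrow {x y : V} (α : x ⟶ y) : vertex k y * arrow k α = arrow k α :=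
  ofPath_mul_comp _ _

lemma arrow_mul_vertex {x y : V} (α : x ⟶ y) : arrow k α * vertex k x = arrow k α :=
  (ofPath_mul_comp _ _).trans (by rw [Quiver.Path.nil_comp]; rfl)

lemma vertex_mul_ofPath {x y : V} (p : Quiver.Path x y) :
    vertex k y * ofPath k ⟨x, y, p⟩ = ofPath k ⟨x, y, p⟩ :=
  ofPath_mul_comp _ _

lemma ofPath_mul_vertex {x y : V} (p : Quiver.Path x y) :
    ofPath k ⟨x, y, p⟩ * vertex k x = ofPath k ⟨x, y, p⟩ :=
  (ofPath_mul_comp _ _).trans (by rw [Quiver.Path.nil_comp])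

lemma ofPath_cons {x y z : V} (p : Quiver.Path x y) (α : y ⟶ z) :
    ofPath k ⟨x, z, p.cons α⟩ = arrow k α * ofPath k ⟨x, y, p⟩ :=
  (ofPath_mul_comp α.toPath p).symm

lemma one_eq_sum [Fintype V] : (1 : PathAlgebra k V) = ∑ x, vertex k x :=
  (one_def).trans (finsum_eq_sum_of_fintype _)

/-- The product of the values of the arrows of a path. -/
def evalPath (ε : V → A) (a : ∀ {x y : V}, (x ⟶ y) → A) {x : V} : {y : V} → Quiver.Path x y → A
  | _, .nil => ε x
  | _, .cons p α => a α * evalPath ε a p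

variable (ε : V → A) (a : ∀ {x y : V}, (x ⟶ y) → A) (hε : ∀ x, ε x * ε x = ε x)
  (hε' : ∀ x y, x ≠ y → ε x * ε y = 0) (ha : ∀ {x y : V} (α : x ⟶ y), ε y * a α = a α)

include hε ha in
lemma mul_evalPath {x y : V} (p : Quiver.Path x y) : ε y * evalPath ε a p = evalPath ε a p := by
  cases p with
  | nil => exact hε x
  | cons p α => rw [evalPath, ← mul_assoc, ha]

include hε in
lemma evalPath_mul {x y : V} (p : Quiver.Path x y) : evalPath ε a p * ε x = evalPath ε a p := by
  induction p with
  | nil => exact hε x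
  | cons p α ih => rw [evalPath, mul_assoc, ih]

include hε ha in
lemma evalPath_comp {x y z : V} (p : Quiver.Path x y) (p' : Quiver.Path y z) :
    evalPath ε a (p.comp p') = evalPath ε a p' * evalPath ε a p := by
  induction p' with
  | nil => exact (mul_evalPath ε a hε ha p).symm
  | cons p' α ih => rw [Quiver.Path.comp_cons, evalPath, evalPath, ih, mul_assoc]

include hε hε' ha in
/-- The universal property of the path algebra. -/
lemma exists_lift [Fintype V] (h1 : ∑ x, ε x = 1) :
    ∃ Φ : PathAlgebra k V →ₐ[k] A,
      ∀ {x y : V} (p : Quiver.Path x y), Φ (ofPath k ⟨x, y, p⟩) = evalPath ε a p := by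
  let φ : PathAlgebra k V →ₗ[k] A := (basis k V).constr k fun p => evalPath ε a p.path
  have hφ (p : QuiverPath V) : φ (ofPath k p) = evalPath ε a p.path :=
    (basis k V).constr_basis _ _ _
  have hmul (p q : QuiverPath V) :
      φ (ofPath k p * ofPath k q) = φ (ofPath k p) * φ (ofPath k q) := by
    by_cases h : q.tgt = p.src
    · obtain ⟨x, y, p⟩ := p
      obtain ⟨x', y', q⟩ := q
      subst h
      rw [ofPath_mul_comp, hφ, hφ, hφ, evalPath_comp ε a hε ha]
    · rw [ofPath_mul_of_ne _ _ h, map_zero, hφ, hφ, ← evalPath_mul ε a hε,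
        ← mul_evalPath ε a hε ha q.path, mul_assoc, ← mul_assoc (ε p.src), hε' _ _ (Ne.symm h),
        zero_mul, mul_zero]
  refine ⟨AlgHom.ofLinearMap φ ?_ fun f g => ?_, fun p => hφ _⟩
  · rw [one_eq_sum, map_sum, ← h1]
    exact Finset.sum_congr rfl fun x _ => hφ _
  · induction f using basis_induction with
    | zero => rw [zero_mul, map_zero, zero_mul]
    | add f f' hf hf' => rw [add_mul, map_add, hf, hf', map_add, add_mul]
    | smul c p =>
      rw [smul_mul_assoc, map_smul, map_smul, smul_mul_assoc]
      congr 1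
      induction g using basis_induction with
      | zero => rw [mul_zero, map_zero, mul_zero]
      | add f f' hf hf' => rw [mul_add, map_add, hf, hf', map_add, mul_add]
      | smul c q => rw [mul_smul_comm, map_smul, hmul, map_smul, mul_smul_comm]

end lift

variable {k : Type u} {V : Type v} [Field k] [Quiver.{w} V] [Finite V]

/-- The idempotents of `kQ/I` at the vertices are nonzero if `I` is contained in the arrow ideal. -/
lemma vertex_notMem (I : TwoSidedIdeal (PathAlgebra k V)) (hI : I ≤ arrowIdeal k V) (x : V) :
    vertex k x ∉ I := by
  classical
  have := Fintype.ofFinite V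
  -- The algebra map to `k` that kills all arrows and all other vertices.
  obtain ⟨Φ, hΦ⟩ := exists_lift (k := k) (A := k) (fun y => if y = x then 1 else 0) (fun _ => 0)
    (fun y => by simp) (fun y z h => by
      by_cases hy : y = x
      · have hz : z ≠ x := fun hz => h (hy.trans hz.symm)
        simp [hz]
      · simp [hy]) (fun _ => mul_zero _) (by simp)
  have h : arrowIdeal k V ≤ TwoSidedIdeal.ker Φ := by
    refine TwoSidedIdeal.span_le.2 ?_
    rintro _ ⟨y, z, α, rfl⟩
    exact (TwoSidedIdeal.mem_ker Φ).2 ((hΦ _).trans (zero_mul _))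
  intro hx
  have := (TwoSidedIdeal.mem_ker Φ).1 (h (hI hx))
  rw [vertex, hΦ] at this
  simp [evalPath] at this

end PathAlgebra

section glue

open PathAlgebra

variable {k : Type u} {V : Type v} [Field k] [Quiver.{w} V] {E : V → V}

omit [Quiver.{w} V] in
lemma glueVertex_eq_iff (hE : Function.Involutive E) (x y : V) :
    glueVertex E x = glueVertex E y ↔ x = y ∨ x = E y := by
  constructor
  · intro h
    have : x ∈ (glueVertex E y).1 := h ▸ Set.mem_insert x {E x}
    exact this
  · rintro (rfl | rfl)
    · rfl
    · refine Subtype.ext ?_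
      change ({E y, E (E y)} : Set V) = {y, E y}
      rw [hE y, Set.pair_comm]

omit [Quiver.{w} V] in
lemma glueVertex_surjective : Function.Surjective (glueVertex E) := by
  rintro ⟨_, x, rfl⟩
  exact ⟨x, rfl⟩

lemma glueMap_ofPath (p : QuiverPath V) :
    glueMap k E (ofPath k p) = ofPath k (gluePath E p) :=
  (basis k V).constr_basis _ _ _

lemma glueMap_vertex (x : V) :
    glueMap k E (vertex k x) = vertex k (V := GluedQuiver E) (glueVertex E x) :=
  glueMap_ofPath _

/-- The map `kQ → kQ(E)` is not multiplicative, as more paths compose in `Q(E)`, but it preserves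
the products of elements that meet at one vertex of `Q`. -/
lemma glueMap_mul (f g : PathAlgebra k V) (x : V) [Finite V] :
    glueMap k E (f * vertex k x) * glueMap k E (vertex k x * g) =
      glueMap k E (f * vertex k x * g) := by
  induction f using basis_induction with
  | zero => simp only [zero_mul, map_zero]
  | add f f' hf hf' => simp only [add_mul, map_add, hf, hf']
  | smul c p =>
  induction g using basis_induction with
  | zero => simp only [mul_zero, map_zero]
  | add f f' hf hf' => simp only [mul_add, map_add, hf, hf']
  | smul d q =>
  simp only [smul_mul_assoc, mul_smul_comm, map_smul]
  congr 2
  obtain ⟨y, z, p⟩ := p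
  obtain ⟨y', z', q⟩ := q
  by_cases hx : x = y
  · subst hx
    rw [ofPath_mul_vertex]
    by_cases hx' : z' = x
    · subst hx'
      rw [vertex_mul_ofPath, ofPath_mul_comp, glueMap_ofPath, glueMap_ofPath, glueMap_ofPath]
      refine (ofPath_mul_comp _ _).trans ?_
      rw [← Prefunctor.mapPath_comp]
      rfl
    · rw [vertex, ofPath_mul_of_ne _ _ hx', ofPath_mul_of_ne _ _ hx', map_zero, mul_zero]
  · rw [vertex, ofPath_mul_of_ne _ _ hx, map_zero, zero_mul, zero_mul, map_zero]

variable [Finite V] (I : TwoSidedIdeal (PathAlgebra k V)) (E)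

/-- The linear map `kQ/I → kQ(E)/I(E)` that sends each path to the same path. -/
def glueQuotient : QuiverAlgebra I →ₗ[k] QuiverAlgebra (gluedIdeal I E) :=
  { I.ringCon.toAddCon.lift
      (((gluedIdeal I E).ringCon.mkₐ (α := k)).toLinearMap ∘ₗ glueMap k E).toAddMonoidHom
      fun f g h => by
        refine (RingCon.eq _).2 ((TwoSidedIdeal.rel_iff _ _ _).2 ?_)
        rw [← map_sub]
        exact TwoSidedIdeal.subset_span ⟨_, (TwoSidedIdeal.rel_iff _ _ _).1 h, rfl⟩ with
    map_smul' := fun c f => by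
      obtain ⟨f, rfl⟩ := I.ringCon.mkₐ_surjective (α := k) f
      exact (((gluedIdeal I E).ringCon.mkₐ (α := k)).toLinearMap ∘ₗ glueMap k E).map_smul c f }

lemma glueQuotient_mk (f : PathAlgebra k V) :
    glueQuotient E I (I.ringCon.mkₐ (α := k) f) =
      (gluedIdeal I E).ringCon.mkₐ (α := k) (glueMap k E f) := rfl

lemma adjoin_range_glueQuotient :
    Algebra.adjoin k (Set.range (glueQuotient E I)) = ⊤ := by
  have hv (o : GluedQuiver E) : (gluedIdeal I E).ringCon.mkₐ (α := k) (vertex k o) ∈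
      Algebra.adjoin k (Set.range (glueQuotient E I)) := by
    obtain ⟨x, rfl⟩ := glueVertex_surjective o
    refine Algebra.subset_adjoin ⟨I.ringCon.mkₐ (α := k) (vertex k x), ?_⟩
    rw [glueQuotient_mk, glueMap_vertex]
  have hp {o o' : GluedQuiver E} (p : Quiver.Path o o') :
      (gluedIdeal I E).ringCon.mkₐ (α := k) (ofPath k ⟨o, o', p⟩) ∈
        Algebra.adjoin k (Set.range (glueQuotient E I)) := by
    induction p with
    | nil => exact hv o
    | cons p α ih =>
      rw [ofPath_cons, map_mul]
      refine Subalgebra.mul_mem _ ?_ ih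
      obtain ⟨α⟩ := α
      refine Algebra.subset_adjoin ⟨I.ringCon.mkₐ (α := k) (arrow k α), ?_⟩
      rw [glueQuotient_mk, arrow, glueMap_ofPath]
      rfl
  rw [eq_top_iff]
  rintro f -
  obtain ⟨f, rfl⟩ := (gluedIdeal I E).ringCon.mkₐ_surjective (α := k) f
  induction f using basis_induction with
  | zero => rw [map_zero]; exact Subalgebra.zero_mem _
  | add f g hf hg => rw [map_add]; exact Subalgebra.add_mem _ hf hg
  | smul c p => rw [map_smul]; exact Subalgebra.smul_mem _ (hp p.path) c

/-- The universal property of the gluing of `kQ/I` along `E`. -/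
lemma exists_lift_glueQuotient [Fintype (GluedQuiver E)] {A : Type*} [Ring A] [Algebra k A]
    (γ : QuiverAlgebra I →ₗ[k] A)
    (hmul : ∀ (s t : PathAlgebra k V) (x : V), γ (I.ringCon.mkₐ (α := k) (s * vertex k x)) *
      γ (I.ringCon.mkₐ (α := k) (vertex k x * t)) =
        γ (I.ringCon.mkₐ (α := k) (s * vertex k x * t)))
    (ε : GluedQuiver E → A)
    (hε : ∀ x, γ (I.ringCon.mkₐ (α := k) (vertex k x)) = ε (glueVertex E x))
    (hε' : ∀ o o', o ≠ o' → ε o * ε o' = 0) (h1 : ∑ o, ε o = 1) :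
    ∃ Φ : QuiverAlgebra (gluedIdeal I E) →ₐ[k] A, ∀ s, Φ (glueQuotient E I s) = γ s := by
  let a {o o' : GluedQuiver E} (α : o ⟶ o') : A :=
    match α with
    | .arrow f => γ (I.ringCon.mkₐ (α := k) (arrow k f))
  have hεε (o : GluedQuiver E) : ε o * ε o = ε o := by
    obtain ⟨x, rfl⟩ := glueVertex_surjective o
    have := hmul (vertex k x) (vertex k x) x
    rw [vertex_mul_self, vertex_mul_self, hε] at this
    exact this
  obtain ⟨Φ, hΦ⟩ := PathAlgebra.exists_lift (k := k) ε a hεε hε' (fun {o o'} α => by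
    obtain @⟨x, y, α⟩ := α
    have := hmul (vertex k y) (arrow k α) y
    rw [vertex_mul_self, vertex_mul_arrow, hε] at this
    exact this) h1
  have hΦ' (f : PathAlgebra k V) : Φ (glueMap k E f) = γ (I.ringCon.mkₐ (α := k) f) := by
    induction f using basis_induction with
    | zero => simp only [map_zero]
    | add f g hf hg => simp only [map_add, hf, hg]
    | smul c p =>
      simp only [map_smul]
      congr 1
      obtain ⟨x, y, p⟩ := p
      rw [glueMap_ofPath]
      refine (hΦ _).trans ?_
      induction p with
      | nil => exact (hε x).symm
      | @cons y z p α ih =>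
        rw [ofPath_cons, ← arrow_mul_vertex, ← hmul, arrow_mul_vertex, vertex_mul_ofPath, ← ih]
        rfl
  have hI : gluedIdeal I E ≤ TwoSidedIdeal.ker Φ := by
    refine TwoSidedIdeal.span_le.2 ?_
    rintro _ ⟨f, hf, rfl⟩
    refine (TwoSidedIdeal.mem_ker Φ).2 ((hΦ' f).trans ?_)
    have : I.ringCon.mkₐ (α := k) f = 0 := (RingCon.eq _).2 hf
    rw [this, map_zero]
  refine ⟨(gluedIdeal I E).ringCon.liftₐ Φ (fun f g h => ?_), fun s => ?_⟩
  · have := hI ((TwoSidedIdeal.rel_iff _ _ _).1 h)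
    rw [TwoSidedIdeal.mem_ker, map_sub, sub_eq_zero] at this
    exact this
  · obtain ⟨s, rfl⟩ := I.ringCon.mkₐ_surjective (α := k) s
    exact hΦ' s

variable {E I}

/-- The gluing algebra `kQ(E)/I(E)` as a gluing in the sense of `GluedAlgebra`. The sets of
vertices are lifted to the universe of the algebras. -/
def gluedAlgebra [Fintype V] [Fintype (GluedQuiver E)] (hI : I ≤ arrowIdeal k V)
    (hE : Function.Involutive E) :
    GluedAlgebra k (QuiverAlgebra I) (QuiverAlgebra (gluedIdeal I E))
      (ULift.{max u v w} V) (ULift.{max u v w} (GluedQuiver E)) :=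
  have hq (o : GluedQuiver E) :
      glueVertex E (Function.surjInv (glueVertex_surjective (E := E)) o) = o :=
    Function.surjInv_eq _ o
  { e := fun x => I.ringCon.mkₐ (α := k) (vertex k x.down)
    complete :=
      { idem := fun x => by rw [IsIdempotentElem, ← map_mul, vertex_mul_self]
        ortho := fun x y h => by
          simp only
          rw [← map_mul, vertex_mul_of_ne fun h' => h (ULift.ext _ _ h'), map_zero]
        complete := by
          rw [← map_sum]
          exact (congrArg _ ((Equiv.ulift.sum_comp (vertex k)).trans one_eq_sum.symm)).trans
            (map_one _) }
    e_ne_zero := fun x h => vertex_notMem I hI x.down ((RingCon.eq _).1 h)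
    E := fun x => ⟨E x.down⟩
    involutive := fun x => ULift.ext _ _ (hE x.down)
    q := fun x => ⟨glueVertex E x.down⟩
    q_eq_iff := fun x y => by
      simp only [ULift.ext_iff]
      exact glueVertex_eq_iff hE _ _
    r := fun o => ⟨Function.surjInv (glueVertex_surjective (E := E)) o.down⟩
    q_r := fun o => ULift.ext _ _ (hq o.down)
    γ := glueQuotient E I
    γ_mul := fun s t x => by
      obtain ⟨s, rfl⟩ := I.ringCon.mkₐ_surjective (α := k) s
      obtain ⟨t, rfl⟩ := I.ringCon.mkₐ_surjective (α := k) t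
      simp only [← map_mul, glueQuotient_mk, glueMap_mul]
    γ_E := fun x => by
      simp only [glueQuotient_mk, glueMap_vertex]
      rw [(glueVertex_eq_iff hE (E x.down) x.down).2 (Or.inr rfl)]
    γ_orthogonal := fun x y h => by
      simp only [glueQuotient_mk, glueMap_vertex]
      rw [← map_mul, vertex_mul_of_ne fun h' => h (ULift.ext _ _ h'), map_zero]
    γ_sum := by
      simp only [glueQuotient_mk, glueMap_vertex, hq]
      rw [← map_sum]
      exact (congrArg _ ((Equiv.ulift.sum_comp (vertex k (V := GluedQuiver E))).trans
        one_eq_sum.symm)).trans (map_one _)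
    γ_adjoin := adjoin_range_glueQuotient E I
    exists_lift := fun {A} _ _ γ hmul hγE horth hsum => by
      refine exists_lift_glueQuotient E I γ (fun s t x => ?_)
        (fun o => γ (I.ringCon.mkₐ (α := k)
          (vertex k (Function.surjInv (glueVertex_surjective (E := E)) o)))) (fun x => ?_)
        (fun o o' h => ?_) ?_
      · simpa only [← map_mul] using
          hmul (I.ringCon.mkₐ (α := k) s) (I.ringCon.mkₐ (α := k) t) ⟨x⟩
      · obtain h | h := (glueVertex_eq_iff hE _ _).1 (hq (glueVertex E x))
        · rw [h]
        · rw [h]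
          exact (hγE ⟨x⟩).symm
      · refine horth ⟨_⟩ ⟨_⟩ fun h' => h ?_
        rw [← hq o, ← hq o']
        exact congrArg ULift.down h'
      · rw [← hsum, ← Equiv.ulift.sum_comp]
        rfl }

end glue

theorem theorem6p9 {k : Type u} [Field k] [IsAlgClosed k]
    {V : Type v} [Quiver.{w} V] [Finite V] [∀ x y : V, Finite (x ⟶ y)]
    (I : TwoSidedIdeal (PathAlgebra k V)) (hI : I ≤ PathAlgebra.arrowIdeal k V)
    (E : V → V) (hE : Function.Involutive E)
    [FiniteDimensional k (QuiverAlgebra I)]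
    [FiniteDimensional k (QuiverAlgebra (gluedIdeal I E))]
    [HasDerivedCategory.{w'} (FGModuleCat (QuiverAlgebra I))]
    [HasDerivedCategory.{w''} (FGModuleCat (QuiverAlgebra (gluedIdeal I E)))] :
    SingularityEquivalent (QuiverAlgebra I) (QuiverAlgebra (gluedIdeal I E)) := by
  have := Fintype.ofFinite V
  have := Fintype.ofFinite (GluedQuiver E)
  exact (gluedAlgebra hI hE).singularityEquivalent

end
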